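/- All Hilbert spaces are complex and separable, $\langle\lambda,\eta\rangle=\sum_{j}\lambda_j\overline{\eta_j}$, and $\mathbb B^d$ is the open unit ball of $\mathbb C^d$. For a Hilbert space $\mathcal Y$, the Drury--Arveson space $\mathcal H_{\mathcal Y}(k_d)$ is the Hilbert space of power series $f(\lambda)=\sum_{n\in\mathbb Z_+^d}f_n\lambda^n$ on $\mathbb B^d$, $f_n\in\mathcal Y$, with $\|f\|^2=\sum_n\frac{n!}{|n|!}\|f_n\|^2<\infty$. A function $\Phi:\mathbb B^d\to\mathcal L(\mathcal F,\mathcal Y)$ is in the Schur class $\mathcal S_d(\mathcal F,\mathcal Y)$ if it is analytic and the multiplication operator $M_\Phi:h\mapsto\Phi h$ is a contraction from $\mathcal H_{\mathcal F}(k_d)$ to $\mathcal H_{\mathcal Y}(k_d)$; it is McCT-inner if in addition $M_\Phi$ is a partial isometry. Let $\mathcal X,\mathcal Y$ be Hilbert spaces, $E\in\mathcal L(\mathcal X,\mathcal Y)$, and let $\mathbf T=(T_1,\dots,T_d)\in\mathcal L(\mathcal X)^d$ be a commuting tuple. Put $Z(\lambda)T=\sum_j\lambda_jT_j$ and $T^*Z(\lambda)^*=\sum_j\overline{\lambda_j}T_j^*$.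 Assume that $(E,\mathbf T)$ is output stable, i.e. the observability operator $\mathcal O:x\mapsto\sum_n\frac{|n|!}{n!}(E\mathbf T^nx)\lambda^n$ is bounded from $\mathcal X$ to $\mathcal H_{\mathcal Y}(k_d)$, and exactly observable, i.e. $P:=\mathcal O^*\mathcal O$ is strictly positive definite (positive semidefinite and boundedly invertible). Then $I-Z(\lambda)T$ and $I-T^*Z(\lambda)^*$ are invertible for all $\lambda\in\mathbb B^d$, and there exist a Hilbert space $\mathcal F$ and a McCT-inner function $\Phi\in\mathcal S_d(\mathcal F,\mathcal Y)$ such that, for all $\lambda,\eta\in\mathbb B^d$, $$\frac{I_{\mathcal Y}-\Phi(\lambda)\Phi(\eta)^*}{1-\langle\lambda,\eta\rangle}=E(I-Z(\lambda)T)^{-1}P^{-1}(I-T^*Z(\eta)^*)^{-1}E^*.$$ Furthermore, for every $\mathbf x\in\mathcal X$, a function $f\in\mathcal H_{\mathcal Y}(k_d)$ satisfies $\mathcal O^*f=\mathbf x$ if and only if it is of the form $$f(\lambda)=E(I-Z(\lambda)T)^{-1}P^{-1}\mathbf x+\Phi(\lambda)h(\lambda),\qquad h\in\mathcal H_{\mathcal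 F}(k_d).$$ As a consequence (McCullough--Trent Beurling--Lax theorem): a closed subspace $\mathcal M$ of $\mathcal H_{\mathcal Y}(k_d)$ is invariant under multiplication by the coordinate functions $\lambda_1,\dots,\lambda_d$ if and only if there exist a Hilbert space $\mathcal F$ and a McCT-inner $\Phi\in\mathcal S_d(\mathcal F,\mathcal Y)$ such that $\mathcal M=\Phi\cdot\mathcal H_{\mathcal F}(k_d)$. -/

import Mathlib

open scoped InnerProductSpace

universe u v

namespace DA

/-- The multinomial coefficient `|n|! / n!` of a multi-index `n`. -/
noncomputable def weight {d : ℕ} (n : Fin d → ℕ) : ℝ :=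
  (Nat.multinomial Finset.univ n : ℝ)

lemma weight_pos {d : ℕ} (n : Fin d → ℕ) : 0 < weight n := by
  unfold weight
  exact_mod_cast Nat.multinomial_pos Finset.univ n

/-- The Drury–Arveson space `H_Y(k_d)` of power series `f(z) = ∑ f_n z^n` with
`‖f‖² = ∑ (n! / |n|!) ‖f_n‖² < ∞`. An element is stored through its normalized coefficients
`√(n! / |n|!) • f_n`, a square summable family; the Taylor coefficients `f_n` themselves are
`DA.coeff f n` and the values `f(z)` are `DA.eval f z`. -/
abbrev Space (d : ℕ) (Y : Type v) [NormedAddCommGroup Y] [InnerProductSpace ℂ Y] : Type v :=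
  lp (fun _ : Fin d → ℕ => Y) 2

/-- The Taylor coefficient `f_n`. -/
noncomputable def coeff {d : ℕ} {Y : Type v} [NormedAddCommGroup Y] [InnerProductSpace ℂ Y]
    (f : Space d Y) (n : Fin d → ℕ) : Y :=
  ((Real.sqrt (weight n) : ℝ) : ℂ) • f n

/-- The value `f(z) = ∑ f_n z^n`. -/
noncomputable def eval {d : ℕ} {Y : Type v} [NormedAddCommGroup Y] [InnerProductSpace ℂ Y]
    (f : Space d Y) (z : EuclideanSpace ℂ (Fin d)) : Y :=
  ∑' n : Fin d → ℕ, (∏ j, z j ^ n j) • coeff f n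

lemma norm_coeff_sq {d : ℕ} {Y : Type v} [NormedAddCommGroup Y] [InnerProductSpace ℂ Y]
    (f : Space d Y) (n : Fin d → ℕ) : (weight n)⁻¹ * ‖coeff f n‖ ^ 2 = ‖f n‖ ^ 2 := by
  have h := weight_pos n
  rw [coeff, norm_smul, mul_pow, Complex.norm_real, Real.norm_eq_abs, sq_abs,
    Real.sq_sqrt h.le, inv_mul_cancel_left₀ h.ne']

/-- `‖f‖² = ∑ (n! / |n|!) ‖f_n‖²`. -/
theorem hasSum_norm_sq {d : ℕ} {Y : Type v} [NormedAddCommGroup Y] [InnerProductSpace ℂ Y]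
    (f : Space d Y) :
    HasSum (fun n : Fin d → ℕ => (weight n)⁻¹ * ‖coeff f n‖ ^ 2) (‖f‖ ^ 2) := by
  simp only [norm_coeff_sq]
  have h := lp.hasSum_norm (p := 2) (by norm_num) f
  simpa using h

/-- Every family with `∑ (n! / |n|!) ‖a_n‖² < ∞` is the family of Taylor coefficients of exactly
one element of the space. -/
theorem existsUnique_coeff {d : ℕ} {Y : Type v} [NormedAddCommGroup Y] [InnerProductSpace ℂ Y]
    (a : (Fin d → ℕ) → Y) (ha : Summable fun n => (weight n)⁻¹ * ‖a n‖ ^ 2) :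
    ∃! f : Space d Y, ∀ n, coeff f n = a n := by
  have hs : ∀ n : Fin d → ℕ, ((Real.sqrt (weight n) : ℝ) : ℂ) ≠ 0 := fun n => by
    exact_mod_cast (Real.sqrt_pos.2 (weight_pos n)).ne'
  have hmem : Memℓp (fun n : Fin d → ℕ => (((Real.sqrt (weight n) : ℝ) : ℂ))⁻¹ • a n) 2 := by
    refine memℓp_gen ?_
    convert ha using 2 with n
    have h := weight_pos n
    rw [norm_smul, norm_inv, Complex.norm_real, Real.norm_eq_abs]
    simp only [ENNReal.toReal_ofNat, Real.rpow_ofNat]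
    rw [mul_pow, inv_pow, sq_abs, Real.sq_sqrt h.le]
  refine ⟨⟨_, hmem⟩, fun n => ?_, fun g hg => ?_⟩
  · exact smul_inv_smul₀ (hs n) (a n)
  · ext n
    have := hg n
    rw [coeff] at this
    change g n = (((Real.sqrt (weight n) : ℝ) : ℂ))⁻¹ • a n
    rw [← this, inv_smul_smul₀ (hs n)]

/-- The power `T^n = T_1^{n_1} ⋯ T_d^{n_d}` of a commuting tuple. -/
noncomputable def opPow {d : ℕ} {X : Type u} [NormedAddCommGroup X] [InnerProductSpace ℂ X]
    (T : Fin d → X →L[ℂ] X) (n : Fin d → ℕ) : X →L[ℂ] X :=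
  (List.ofFn fun j => T j ^ n j).prod

section Observability

variable {d : ℕ} {X : Type u} [NormedAddCommGroup X] [InnerProductSpace ℂ X]
  {Y : Type v} [NormedAddCommGroup Y] [InnerProductSpace ℂ Y]

/-- `O` is the observability operator `x ↦ ∑ (|n|! / n!) (E T^n x) z^n` as a bounded operator from
`X` to the Drury–Arveson space (for a commuting tuple `T`). -/
def IsObservability (E : X →L[ℂ] Y) (T : Fin d → X →L[ℂ] X) (O : X →L[ℂ] Space d Y) : Prop :=
  ∀ (x : X) (n : Fin d → ℕ), coeff (O x) n = ((weight n : ℝ) : ℂ) • E (opPow T n x)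

/-- Output stability of a pair `(E, T)` with `T` commuting: the observability operator is bounded
from `X` to the Drury–Arveson space. -/
def OutputStable (E : X →L[ℂ] Y) (T : Fin d → X →L[ℂ] X) : Prop :=
  ∃ O : X →L[ℂ] Space d Y, IsObservability E T O

/-- The observability operator of an output stable pair. -/
noncomputable def observability {E : X →L[ℂ] Y} {T : Fin d → X →L[ℂ] X}
    (h : OutputStable E T) : X →L[ℂ] Space d Y :=
  h.choose

/-- The observability gramian `P = O* O`. -/
noncomputable def gramian [CompleteSpace X] [CompleteSpace Y]
    {E : X →L[ℂ] Y} {T : Fin d → X →L[ℂ] X} (h : OutputStable E T) : X →L[ℂ] X :=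
  (ContinuousLinearMap.adjoint (observability h)).comp (observability h)

/-- Exact observability: the gramian is strictly positive definite, i.e. positive semidefinite and
boundedly invertible. -/
def ExactlyObservable [CompleteSpace X] [CompleteSpace Y]
    {E : X →L[ℂ] Y} {T : Fin d → X →L[ℂ] X} (h : OutputStable E T) : Prop :=
  IsStrictlyPositive (gramian h)

/-- The operator `I - Z(z) T = I - ∑ z_j T_j`. -/
noncomputable def pencil (T : Fin d → X →L[ℂ] X) (z : EuclideanSpace ℂ (Fin d)) : X →L[ℂ] X :=
  1 - ∑ j, z j • T j

/-- The operator `I - T* Z(w)* = I - ∑ conj(w_j) T_j*`. -/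
noncomputable def adjPencil [CompleteSpace X]
    (T : Fin d → X →L[ℂ] X) (w : EuclideanSpace ℂ (Fin d)) : X →L[ℂ] X :=
  1 - ∑ j, (starRingEnd ℂ (w j)) • ContinuousLinearMap.adjoint (T j)

end Observability

section Multipliers

variable {d : ℕ} {F : Type u} [NormedAddCommGroup F] [InnerProductSpace ℂ F]
  {Y : Type v} [NormedAddCommGroup Y] [InnerProductSpace ℂ Y]

/-- `M` is the operator `M_Φ` of multiplication by `Φ`. -/
def IsMultiplicationBy (Φ : EuclideanSpace ℂ (Fin d) → F →L[ℂ] Y)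
    (M : Space d F →L[ℂ] Space d Y) : Prop :=
  ∀ h : Space d F, ∀ z ∈ Metric.ball (0 : EuclideanSpace ℂ (Fin d)) 1,
    eval (M h) z = Φ z (eval h z)

/-- The Schur class: analytic functions on the unit ball that are contractive multipliers between
Drury–Arveson spaces. -/
structure IsSchur (Φ : EuclideanSpace ℂ (Fin d) → F →L[ℂ] Y) : Prop where
  analytic : AnalyticOnNhd ℂ Φ (Metric.ball 0 1)
  contractive : ∃ M : Space d F →L[ℂ] Space d Y, IsMultiplicationBy Φ M ∧ ‖M‖ ≤ 1

/-- A partial isometry: isometric on the orthogonal complement of its kernel. -/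
def IsPartialIsometry {H : Type u} [NormedAddCommGroup H] [InnerProductSpace ℂ H]
    {K : Type v} [NormedAddCommGroup K] [InnerProductSpace ℂ K] (M : H →L[ℂ] K) : Prop :=
  ∀ h ∈ (LinearMap.ker M.toLinearMap)ᗮ, ‖M h‖ = ‖h‖

/-- McCT-inner functions: Schur-class functions with `M_Φ` a partial isometry. -/
structure IsMcCTInner (Φ : EuclideanSpace ℂ (Fin d) → F →L[ℂ] Y) : Prop where
  schur : IsSchur Φ
  partialIsometry : ∃ M : Space d F →L[ℂ] Space d Y, IsMultiplicationBy Φ M ∧ IsPartialIsometry M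

/-- Invariance under the coordinate multipliers: with `f`, the functions `z ↦ z_j f(z)` also belong
to the subspace. -/
def ShiftInvariant (M : Submodule ℂ (Space d Y)) : Prop :=
  ∀ j : Fin d, ∀ f ∈ M, ∃ g ∈ M, ∀ z ∈ Metric.ball (0 : EuclideanSpace ℂ (Fin d)) 1,
    eval g z = z j • eval f z

end Multipliers

end DA

-- Let `S_j` be multiplication by the `j`-th coordinate; its adjoint is `bwd j`. The weights make
-- `‖f‖² = ‖f_0‖² + ∑ ‖S_j* f‖²` (`inner_eq_inner_zero_add_sum`, in polarized form). Paired with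
-- kernel functions, the joint eigenvectors of the `S_j*`, this splitting yields the reproducing
-- kernel `1 / (1 - ⟨z, w⟩)`; iterated, it shows that the weighted degree-`K` sums of `‖S*^n f‖²`
-- tend to `0`.
--
-- Both claims reduce to one construction for a closed subspace `N` invariant under the `S_j`, with
-- projection `Q`. The `S_j*` preserve the complement of `N`, so `Q S_j* = Q S_j* Q`, and `D = Q - ∑
-- S_j Q S_j*` satisfies `⟨D f, f⟩ = ‖(Q f)_0‖² + ∑ ‖(1 - Q) S_j* Q f‖²`. Hence `D = G* G` for an
-- explicit `G` (`norm_defect_sq`). The operator `Γ` with normalized coefficients `√(|n|!/n!) G S*^n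
-- f` then satisfies `‖Γ f‖ = ‖Q f‖` by telescoping, that is `Γ* Γ = Q`. On kernels `Γ k_w y = k_w
-- (G k_w y)`, so `Γ*` is multiplication by `Φ(z) = ev_z G*`, a partial isometry with range `N`
-- (`exists_isMcCTInner`).
--
-- For interpolation, take `N = ker O*`. Since `O T_j = S_j* O`, it is invariant, and its projection
-- is `1 - O P⁻¹ O*`. Testing this on kernels gives the kernel identity; the solutions of `O* f = x`
-- form the translate `O P⁻¹ x + N`.

universe w

namespace DA

/-! ### Multinomial weights and summation by total degree -/

section MultiIndices

variable {d : ℕ}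

/-- Induction on multi-indices, one unit at a time. -/
theorem multiIndex_induction {p : (Fin d → ℕ) → Prop} (h0 : p 0)
    (hs : ∀ n j, p n → p (n + Pi.single j 1)) (n : Fin d → ℕ) : p n := by
  obtain ⟨k, hk⟩ : ∃ k, ∑ i, n i = k := ⟨_, rfl⟩
  induction k generalizing n with
  | zero =>
    have : n = 0 := by
      funext i
      exact (Finset.sum_eq_zero_iff.1 hk) i (Finset.mem_univ i)
    rwa [this]
  | succ k ih =>
    obtain ⟨j, hj⟩ : ∃ j, n j ≠ 0 := by
      by_contra! h
      simp [h] at hk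
    have hn : n = (n - Pi.single j 1) + Pi.single j 1 := by
      funext i
      by_cases hi : i = j
      · subst hi; simp; omega
      · simp [hi]
    rw [hn]
    refine hs _ j (ih _ ?_)
    rw [hn] at hk
    simp only [Pi.add_apply, Finset.sum_add_distrib, Finset.sum_pi_single',
      Finset.mem_univ, if_true] at hk
    omega

theorem sum_add_single (n : Fin d → ℕ) (j : Fin d) :
    ∑ i, (n + Pi.single j 1 : Fin d → ℕ) i = ∑ i, n i + 1 := by
  simp [Finset.sum_add_distrib]

theorem weight_zero : weight (0 : Fin d → ℕ) = 1 := by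
  simp [weight, Nat.multinomial]

theorem weight_add_single (n : Fin d → ℕ) (j : Fin d) :
    ((n j : ℝ) + 1) * weight (n + Pi.single j 1) = ((∑ i, n i : ℕ) + 1 : ℝ) * weight n := by
  have h1 := Nat.multinomial_spec Finset.univ n
  have h2 := Nat.multinomial_spec Finset.univ (n + Pi.single j 1)
  rw [sum_add_single, Nat.factorial_succ, ← h1] at h2
  have h3 : ∏ i, ((n + Pi.single j 1 : Fin d → ℕ) i).factorial = (n j + 1) * ∏ i, (n i).factorial := by
    rw [← Finset.mul_prod_erase _ _ (Finset.mem_univ j),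
      ← Finset.mul_prod_erase _ (fun i => (n i).factorial) (Finset.mem_univ j), ← mul_assoc]
    congr 1
    · simp [Nat.factorial_succ]
    · refine Finset.prod_congr rfl fun i hi => ?_
      simp [Finset.ne_of_mem_erase hi]
  rw [h3] at h2
  have h4 : 0 < ∏ i, (n i).factorial := Finset.prod_pos fun i _ => Nat.factorial_pos _
  have h5 : (n j + 1) * Nat.multinomial Finset.univ (n + Pi.single j 1) =
      (∑ i, n i + 1) * Nat.multinomial Finset.univ n := by
    apply Nat.eq_of_mul_eq_mul_left h4
    linarith
  unfold weight
  exact_mod_cast h5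

/-- The factor `(n_j + 1) / (|n| + 1)` in the backward shift. -/
noncomputable def ratio (n : Fin d → ℕ) (j : Fin d) : ℝ :=
  ((n j : ℝ) + 1) / ((∑ i, n i : ℕ) + 1 : ℝ)

theorem ratio_nonneg (n : Fin d → ℕ) (j : Fin d) : 0 ≤ ratio n j := by
  unfold ratio; positivity

theorem ratio_le_one (n : Fin d → ℕ) (j : Fin d) : ratio n j ≤ 1 := by
  unfold ratio
  rw [div_le_one (by positivity)]
  have : n j ≤ ∑ i, n i := Finset.single_le_sum (fun _ _ => Nat.zero_le _) (Finset.mem_univ j)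
  have : (n j : ℝ) ≤ (∑ i, n i : ℕ) := by exact_mod_cast this
  linarith

/-- The adjoint of a coordinate multiplication carries the factor `√(weight n / weight (n + e_j))`
in normalized coefficients; this identifies that quotient with `ratio n j`. -/
theorem ratio_mul_weight (n : Fin d → ℕ) (j : Fin d) :
    ratio n j * weight (n + Pi.single j 1) = weight n := by
  rw [ratio, div_mul_eq_mul_div, weight_add_single, mul_div_cancel_left₀]
  positivity

theorem sqrt_ratio_mul_sqrt_weight (n : Fin d → ℕ) (j : Fin d) :
    √(ratio n j) * √(weight (n + Pi.single j 1)) = √(weight n) := by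
  rw [← Real.sqrt_mul (ratio_nonneg n j), ratio_mul_weight]

/-- The fraction `m_j / |m|`; its value at a shifted multi-index is `ratio`. -/
noncomputable def share (m : Fin d → ℕ) (j : Fin d) : ℝ := (m j : ℝ) / (∑ i, m i : ℕ)

theorem share_add_single (n : Fin d → ℕ) (j : Fin d) :
    share (n + Pi.single j 1) j = ratio n j := by
  unfold share ratio
  rw [sum_add_single]
  simp

theorem sum_share {m : Fin d → ℕ} (hm : m ≠ 0) : ∑ j, share m j = 1 := by
  unfold share
  rw [← Finset.sum_div]
  push_cast
  apply div_self
  intro h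
  apply hm
  have h' : ∑ i, m i = 0 := by exact_mod_cast h
  funext i
  exact (Finset.sum_eq_zero_iff.1 h') i (Finset.mem_univ i)

/-- Here `0 / 0 = 0` is the right default: no backward shift sees the constant term. -/
theorem share_zero (j : Fin d) : share (0 : Fin d → ℕ) j = 0 := by
  simp [share]

theorem add_single_injective (j : Fin d) :
    Function.Injective fun n : Fin d → ℕ => n + Pi.single j 1 :=
  fun _ _ h => add_right_cancel h

theorem mem_range_add_single {m : Fin d → ℕ} {j : Fin d} (h : m j ≠ 0) :
    ∃ n : Fin d → ℕ, n + Pi.single j 1 = m := by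
  refine ⟨m - Pi.single j 1, ?_⟩
  funext i
  by_cases hi : i = j
  · subst hi; simp; omega
  · simp [hi]

theorem share_eq_zero_of_notMem_range {m : Fin d → ℕ} {j : Fin d}
    (h : m ∉ Set.range fun n : Fin d → ℕ => n + Pi.single j 1) : share m j = 0 := by
  have : m j = 0 := by
    by_contra hm
    exact h (mem_range_add_single hm)
  simp [share, this]

/-- The multi-indices of total degree less than `K`. -/
def degreeLT (K : ℕ) : Finset (Fin d → ℕ) :=
  (Finset.range K).biUnion fun k => Finset.piAntidiag Finset.univ k

theorem mem_degreeLT {K : ℕ} {n : Fin d → ℕ} : n ∈ degreeLT K ↔ ∑ i, n i < K := by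
  simp [degreeLT]

theorem sum_degreeLT (K : ℕ) (φ : (Fin d → ℕ) → ℝ) : ∑ n ∈ degreeLT K, φ n =
    ∑ k ∈ Finset.range K, ∑ n ∈ Finset.piAntidiag Finset.univ k, φ n := by
  refine Finset.sum_biUnion fun k _ l _ hkl => ?_
  simp only [Function.onFun, Finset.disjoint_left, Finset.mem_piAntidiag]
  rintro n ⟨h1, -⟩ ⟨h2, -⟩
  exact hkl (h1.symm.trans h2)

theorem degreeLT_mono : Monotone (degreeLT : ℕ → Finset (Fin d → ℕ)) := by
  intro K L hKL n
  rw [mem_degreeLT, mem_degreeLT]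
  omega

theorem tendsto_degreeLT :
    Filter.Tendsto (degreeLT : ℕ → Finset (Fin d → ℕ)) Filter.atTop Filter.atTop :=
  Filter.tendsto_atTop_finset_of_monotone degreeLT_mono fun n =>
    ⟨∑ i, n i + 1, mem_degreeLT.2 (Nat.lt_succ_self _)⟩

theorem tendsto_sum_degree {φ : (Fin d → ℕ) → ℝ} {s : ℝ} (h : HasSum φ s) :
    Filter.Tendsto (fun K => ∑ k ∈ Finset.range K, ∑ n ∈ Finset.piAntidiag Finset.univ k, φ n)
      Filter.atTop (nhds s) := by
  simp only [← sum_degreeLT]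
  exact h.comp tendsto_degreeLT

/-- A family of nonnegative numbers can be summed by total degree. -/
theorem hasSum_of_tendsto_sum_degree {φ : (Fin d → ℕ) → ℝ} (hφ : ∀ n, 0 ≤ φ n) {s : ℝ}
    (h : Filter.Tendsto
      (fun K => ∑ k ∈ Finset.range K, ∑ n ∈ Finset.piAntidiag Finset.univ k, φ n)
      Filter.atTop (nhds s)) : HasSum φ s := by
  have hmono : Monotone fun K => ∑ n ∈ degreeLT K, φ n := fun K L hKL =>
    Finset.sum_le_sum_of_subset_of_nonneg (degreeLT_mono hKL) fun n _ _ => hφ n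
  have h' := h
  simp only [← sum_degreeLT] at h'
  have hbd : ∀ F : Finset (Fin d → ℕ), ∑ n ∈ F, φ n ≤ s := by
    intro F
    obtain ⟨K, hK⟩ := (tendsto_degreeLT.eventually_ge_atTop F).exists
    exact (Finset.sum_le_sum_of_subset_of_nonneg hK fun n _ _ => hφ n).trans
      (hmono.ge_of_tendsto h' K)
  have hs : Summable φ := summable_of_sum_le hφ hbd
  exact tendsto_nhds_unique (tendsto_sum_degree hs.hasSum) h ▸ hs.hasSum

/-- Split each `m` of degree `k + 1` into its shares `m_j / |m|`, which add up to `1`. Writing `m =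
n + e_j`, the share times the weight of `m` is the weight of `n`. -/
theorem sum_degree_succ (k : ℕ) (ψ : (Fin d → ℕ) → ℝ) :
    ∑ m ∈ Finset.piAntidiag Finset.univ (k + 1), weight m * ψ m =
      ∑ n ∈ Finset.piAntidiag Finset.univ k, weight n * ∑ j, ψ (n + Pi.single j 1) := by
  have h1 : ∀ m ∈ Finset.piAntidiag (Finset.univ : Finset (Fin d)) (k + 1),
      weight m * ψ m = ∑ j, share m j * (weight m * ψ m) := by
    intro m hm
    rw [← Finset.sum_mul, sum_share, one_mul]
    rintro rfl
    simp at hm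
  rw [Finset.sum_congr rfl h1, Finset.sum_comm]
  simp_rw [Finset.mul_sum]
  rw [Finset.sum_comm (s := Finset.piAntidiag _ _)]
  refine Finset.sum_congr rfl fun j _ => ?_
  symm
  refine Finset.sum_of_injOn (fun n => n + Pi.single j 1)
    (add_single_injective j).injOn ?_ ?_ ?_
  · intro n hn
    simp only [Finset.mem_coe, Finset.mem_piAntidiag] at hn ⊢
    exact ⟨by rw [← hn.1]; exact sum_add_single n j, by simp⟩
  · intro m hm hm'
    rw [share_eq_zero_of_notMem_range, zero_mul]
    rintro ⟨n, rfl⟩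
    apply hm'
    refine ⟨n, ?_, rfl⟩
    simp only [Finset.mem_coe, Finset.mem_piAntidiag] at hm ⊢
    have h2 : ∑ i, (n + Pi.single j 1 : Fin d → ℕ) i = k + 1 := hm.1
    rw [sum_add_single] at h2
    exact ⟨Nat.succ_injective h2, by simp⟩
  · intro n _
    rw [share_add_single, ← mul_assoc, ratio_mul_weight]

/-- `∑ (|n|! / n!) x^n = 1 / (1 - ∑ x_j)`. -/
theorem hasSum_weight_mul_prod {x : Fin d → ℝ} (hx : ∀ j, 0 ≤ x j) (hx1 : ∑ j, x j < 1) :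
    HasSum (fun n : Fin d → ℕ => weight n * ∏ j, x j ^ n j) (1 - ∑ j, x j)⁻¹ := by
  refine hasSum_of_tendsto_sum_degree (fun n => mul_nonneg (weight_pos n).le
    (Finset.prod_nonneg fun j _ => pow_nonneg (hx j) _)) ?_
  have h := (hasSum_geometric_of_lt_one (Finset.sum_nonneg fun j _ => hx j) hx1).tendsto_sum_nat
  refine h.congr fun K => Finset.sum_congr rfl fun k _ => ?_
  rw [Finset.sum_pow_eq_sum_piAntidiag]
  rfl

end MultiIndices

/-! ### Powers of a commuting tuple -/

section Powers

variable {d : ℕ} {X : Type u} [NormedAddCommGroup X] [InnerProductSpace ℂ X]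

theorem opPow_zero (T : Fin d → X →L[ℂ] X) : opPow T 0 = 1 := by
  simp [opPow]

theorem opPow_succ (T : Fin (d + 1) → X →L[ℂ] X) (n : Fin (d + 1) → ℕ) :
    opPow T n = T 0 ^ n 0 * opPow (fun j => T j.succ) (fun j => n j.succ) := by
  simp [opPow, List.ofFn_succ]

theorem commute_opPow {T : Fin d → X →L[ℂ] X} {A : X →L[ℂ] X} (h : ∀ j, Commute A (T j))
    (n : Fin d → ℕ) : Commute A (opPow T n) := by
  unfold opPow
  refine Commute.list_prod_right _ _ ?_
  intro x hx
  obtain ⟨j, rfl⟩ := (List.mem_ofFn' _ _).1 hx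
  exact (h j).pow_right _

theorem opPow_add_single {T : Fin d → X →L[ℂ] X} (h : ∀ i j, Commute (T i) (T j))
    (n : Fin d → ℕ) (j : Fin d) : opPow T (n + Pi.single j 1) = opPow T n * T j := by
  induction d with
  | zero => exact j.elim0
  | succ d ih =>
    rw [opPow_succ, opPow_succ]
    induction j using Fin.cases with
    | zero =>
      have : (fun i : Fin d => (n + Pi.single 0 1 : Fin (d + 1) → ℕ) i.succ) =
          fun i => n i.succ := by
        funext i; simp
      rw [this, mul_assoc, ← (commute_opPow (fun i => h 0 i.succ) _).eq, ← mul_assoc]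
      simp [pow_succ]
    | succ j =>
      have : (fun i : Fin d => (n + Pi.single j.succ 1 : Fin (d + 1) → ℕ) i.succ) =
          (fun i => n i.succ) + Pi.single j 1 := by
        funext i; simp [Pi.single_apply]
      rw [this, ih (fun i k => h i.succ k.succ), mul_assoc]
      simp

end Powers

/-! ### Operators given by their normalized coefficients -/

section Families

variable {d : ℕ} {X : Type u} [NormedAddCommGroup X] [InnerProductSpace ℂ X]
  {Z : Type v} [NormedAddCommGroup Z] [InnerProductSpace ℂ Z]

theorem hasSum_norm_sq_apply (f : Space d Z) : HasSum (fun n => ‖f n‖ ^ 2) (‖f‖ ^ 2) := by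
  simpa using lp.hasSum_norm (p := 2) (by norm_num) f

/-- The linear map into the Drury–Arveson space with given normalized coefficients. -/
noncomputable def ofFamilyₗ (φ : (Fin d → ℕ) → X →L[ℂ] Z)
    (h : ∀ x, Summable fun n => ‖φ n x‖ ^ 2) : X →ₗ[ℂ] Space d Z where
  toFun x := ⟨fun n => φ n x, memℓp_gen (by simpa using h x)⟩
  map_add' x y := lp.ext (funext fun n => map_add (φ n) x y)
  map_smul' c x := lp.ext (funext fun n => map_smul (φ n) c x)

theorem norm_ofFamilyₗ_sq (φ : (Fin d → ℕ) → X →L[ℂ] Z)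
    (h : ∀ x, Summable fun n => ‖φ n x‖ ^ 2) (x : X) :
    ‖ofFamilyₗ φ h x‖ ^ 2 = ∑' n, ‖φ n x‖ ^ 2 :=
  (hasSum_norm_sq_apply (ofFamilyₗ φ h x)).tsum_eq.symm

/-- The bounded operator into the Drury–Arveson space with given normalized coefficients. -/
noncomputable def ofFamily (φ : (Fin d → ℕ) → X →L[ℂ] Z) (C : ℝ) (hC : 0 ≤ C)
    (h : ∀ x, ∃ s, HasSum (fun n => ‖φ n x‖ ^ 2) s ∧ s ≤ (C * ‖x‖) ^ 2) : X →L[ℂ] Space d Z :=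
  (ofFamilyₗ φ fun x => (h x).choose_spec.1.summable).mkContinuous C fun x => by
    obtain ⟨s, hs, hle⟩ := h x
    refine (pow_le_pow_iff_left₀ (norm_nonneg _) (by positivity) two_ne_zero).1 ?_
    rw [norm_ofFamilyₗ_sq, hs.tsum_eq]
    exact hle

/-- The normalized coefficient `f ↦ f n` as a bounded operator. -/
noncomputable def proj (n : Fin d → ℕ) : Space d Z →L[ℂ] Z :=
  lp.evalCLM ℂ (fun _ : Fin d → ℕ => Z) 2 n

@[simp]
theorem proj_apply (n : Fin d → ℕ) (f : Space d Z) : proj n f = f n := rfl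

end Families

/-! ### Backward shifts and the splitting of the norm -/

section Shifts

variable {d : ℕ} {Y : Type v} [NormedAddCommGroup Y] [InnerProductSpace ℂ Y]

/-- The backward shift, adjoint to the multiplication by the `j`-th coordinate. -/
noncomputable def bwd (j : Fin d) : Space d Y →L[ℂ] Space d Y :=
  ofFamily (fun n => ((√(ratio n j) : ℝ) : ℂ) • proj (n + Pi.single j 1)) 1 zero_le_one
    (fun f => by
      have h1 := (hasSum_norm_sq_apply f).summable
      have h2 : Summable fun n : Fin d → ℕ => ‖f (n + Pi.single j 1)‖ ^ 2 :=
        h1.comp_injective (add_single_injective j)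
      have h3 : ∀ n : Fin d → ℕ,
          ‖(((√(ratio n j) : ℝ) : ℂ) • proj (n + Pi.single j 1)) f‖ ^ 2 ≤
            ‖f (n + Pi.single j 1)‖ ^ 2 := by
        intro n
        rw [smul_apply, norm_smul, mul_pow, Complex.norm_real,
          Real.norm_eq_abs, sq_abs, Real.sq_sqrt (ratio_nonneg n j), proj_apply]
        exact mul_le_of_le_one_left (sq_nonneg _) (ratio_le_one n j)
      have h4 := Summable.of_nonneg_of_le (fun n => sq_nonneg _) h3 h2
      refine ⟨_, h4.hasSum, (h4.tsum_le_tsum h3 h2).trans ?_⟩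
      rw [one_mul, ← (hasSum_norm_sq_apply f).tsum_eq]
      exact tsum_comp_le_tsum_of_inj h1 (fun n => sq_nonneg _) (add_single_injective j))

theorem bwd_apply (j : Fin d) (f : Space d Y) (n : Fin d → ℕ) :
    bwd j f n = ((√(ratio n j) : ℝ) : ℂ) • f (n + Pi.single j 1) := rfl

theorem bwd_commute (i j : Fin d) : Commute (bwd i : Space d Y →L[ℂ] Space d Y) (bwd j) := by
  refine ContinuousLinearMap.ext fun f => ?_
  refine lp.ext (funext fun n => ?_)
  change bwd i (bwd j f) n = bwd j (bwd i f) n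
  simp only [bwd_apply, smul_smul, ← Complex.ofReal_mul]
  rw [add_right_comm]
  congr 2
  rw [← Real.sqrt_mul (ratio_nonneg _ _), ← Real.sqrt_mul (ratio_nonneg _ _)]
  congr 1
  unfold ratio
  rw [sum_add_single, sum_add_single]
  by_cases h : i = j
  · subst h; rfl
  · simp [h, Ne.symm h]
    ring

/-- The inner product of the space splits into the constant terms and the backward shifts. -/
theorem inner_eq_inner_zero_add_sum (f g : Space d Y) :
    ⟪f, g⟫_ℂ = ⟪f 0, g 0⟫_ℂ + ∑ j, ⟪bwd j f, bwd j g⟫_ℂ := by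
  have h1 : ∀ j : Fin d, HasSum (fun m : Fin d → ℕ => ((share m j : ℝ) : ℂ) * ⟪f m, g m⟫_ℂ)
      ⟪bwd j f, bwd j g⟫_ℂ := by
    intro j
    -- Reindex along `n ↦ n + e_j`; off the range of this map the share vanishes.
    rw [← (add_single_injective j).hasSum_iff]
    · refine (lp.hasSum_inner (bwd j f) (bwd j g)).congr_fun ?_
      intro n
      simp only [Function.comp, bwd_apply, inner_smul_left, inner_smul_right, share_add_single,
        Complex.conj_ofReal, ← mul_assoc, ← Complex.ofReal_mul,
        Real.mul_self_sqrt (ratio_nonneg _ _)]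
    · intro m hm
      rw [share_eq_zero_of_notMem_range hm, Complex.ofReal_zero, zero_mul]
  -- Summed over `j`, the shares give `1` except at `m = 0`, where they give `0`; the constant term
  -- fills this gap.
  have h2 := (hasSum_ite_eq (0 : Fin d → ℕ) ⟪f 0, g 0⟫_ℂ).add
    (hasSum_sum fun j (_ : j ∈ Finset.univ) => h1 j)
  refine (lp.hasSum_inner f g).unique (h2.congr_fun ?_)
  intro m
  by_cases hm : m = 0
  · subst hm
    simp [share_zero]
  · rw [if_neg hm, ← Finset.sum_mul, ← Complex.ofReal_sum, sum_share hm]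
    simp

theorem norm_sq_eq_norm_zero_add_sum (f : Space d Y) :
    ‖f‖ ^ 2 = ‖f 0‖ ^ 2 + ∑ j, ‖bwd j f‖ ^ 2 := by
  have h := inner_eq_inner_zero_add_sum f f
  simp only [inner_self_eq_norm_sq_to_K] at h
  exact_mod_cast h

/-- Cauchy–Schwarz, together with `∑ ‖bwd j f‖² ≤ ‖f‖²` from the norm splitting. -/
theorem norm_sum_smul_bwd_le (z : EuclideanSpace ℂ (Fin d)) (f : Space d Y) :
    ‖∑ j, z j • bwd j f‖ ≤ ‖z‖ * ‖f‖ := by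
  calc ‖∑ j, z j • bwd j f‖ ≤ ∑ j, ‖z j‖ * ‖bwd j f‖ :=
        (norm_sum_le _ _).trans_eq (Finset.sum_congr rfl fun j _ => norm_smul _ _)
    _ ≤ √(∑ j, ‖z j‖ ^ 2) * √(∑ j, ‖bwd j f‖ ^ 2) := Real.sum_mul_le_sqrt_mul_sqrt _ _ _
    _ ≤ ‖z‖ * ‖f‖ := by
        rw [← EuclideanSpace.norm_eq]
        refine mul_le_mul_of_nonneg_left (Real.sqrt_le_iff.2 ⟨norm_nonneg _, ?_⟩) (norm_nonneg _)
        rw [norm_sq_eq_norm_zero_add_sum f]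
        exact le_add_of_nonneg_left (sq_nonneg _)

theorem norm_sum_smul_bwd_op_le (z : EuclideanSpace ℂ (Fin d)) :
    ‖∑ j, z j • (bwd j : Space d Y →L[ℂ] Space d Y)‖ ≤ ‖z‖ := by
  refine ContinuousLinearMap.opNorm_le_bound _ (norm_nonneg _) fun f => ?_
  simpa using norm_sum_smul_bwd_le z f

/-- Each backward shift moves coefficients one step towards the origin, so the constant terms of the
shifted functions recover `f`. Thus the pair (constant term, `bwd`) has the identity as
observability operator. -/
theorem sqrt_weight_smul_opPow_bwd_zero (n : Fin d → ℕ) (f : Space d Y) :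
    ((√(weight n) : ℝ) : ℂ) • (opPow bwd n f) 0 = f n := by
  induction n using multiIndex_induction generalizing f with
  | h0 => simp [opPow_zero, weight_zero]
  | hs n j ih =>
    have hr : (0 : ℝ) < √(ratio n j) := by
      apply Real.sqrt_pos.2
      unfold ratio; positivity
    rw [opPow_add_single (bwd_commute (Y := Y)), mul_apply_eq_comp]
    have h := ih (bwd j f)
    rw [bwd_apply, ← sqrt_ratio_mul_sqrt_weight n j, Complex.ofReal_mul, mul_smul] at h
    exact smul_right_injective Y (Complex.ofReal_ne_zero.2 hr.ne') h

end Shifts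

/-! ### Kernel functions and point evaluation -/

section Kernel

variable {d : ℕ} {Y : Type v} [NormedAddCommGroup Y] [InnerProductSpace ℂ Y]

theorem hasSum_weight_mul_norm_prod {z : EuclideanSpace ℂ (Fin d)} (hz : ‖z‖ < 1) :
    HasSum (fun n : Fin d → ℕ => weight n * ‖∏ j, z j ^ n j‖ ^ 2) (1 - ‖z‖ ^ 2)⁻¹ := by
  have h : ∑ j, ‖z j‖ ^ 2 = ‖z‖ ^ 2 := (EuclideanSpace.norm_sq_eq z).symm
  have h' := hasSum_weight_mul_prod (x := fun j => ‖z j‖ ^ 2) (fun j => sq_nonneg _) (by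
    rw [h]; exact pow_lt_one₀ (norm_nonneg _) hz two_ne_zero)
  rw [h] at h'
  refine h'.congr_fun fun n => ?_
  rw [norm_prod, ← Finset.prod_pow]
  simp only [norm_pow, ← pow_mul, mul_comm]

/-- The kernel functions `y ↦ k(·, z) y`. -/
noncomputable def kern (z : EuclideanSpace ℂ (Fin d)) (hz : ‖z‖ < 1) : Y →L[ℂ] Space d Y :=
  ofFamily (fun n => (((√(weight n) : ℝ) : ℂ) * starRingEnd ℂ (∏ j, z j ^ n j)) •
      ContinuousLinearMap.id ℂ Y) (√((1 - ‖z‖ ^ 2)⁻¹)) (Real.sqrt_nonneg _) (fun y => by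
    have h0 : 0 ≤ (1 - ‖z‖ ^ 2)⁻¹ :=
      inv_nonneg.2 (sub_nonneg.2 (pow_le_one₀ (norm_nonneg _) hz.le))
    refine ⟨_, ((hasSum_weight_mul_norm_prod hz).mul_right (‖y‖ ^ 2)).congr_fun ?_, ?_⟩
    · intro n
      rw [smul_apply, norm_smul, norm_mul, RCLike.norm_conj,
        Complex.norm_real, Real.norm_eq_abs, mul_pow, mul_pow, sq_abs,
        Real.sq_sqrt (weight_pos n).le]
      rfl
    · rw [mul_pow, Real.sq_sqrt h0])

theorem kern_apply (z : EuclideanSpace ℂ (Fin d)) (hz : ‖z‖ < 1) (y : Y) (n : Fin d → ℕ) :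
    kern z hz y n = (((√(weight n) : ℝ) : ℂ) * starRingEnd ℂ (∏ j, z j ^ n j)) • y := rfl

theorem kern_apply_zero (z : EuclideanSpace ℂ (Fin d)) (hz : ‖z‖ < 1) (y : Y) :
    kern z hz y 0 = y := by
  simp [kern_apply, weight_zero]

theorem prod_pow_add_single (z : EuclideanSpace ℂ (Fin d)) (n : Fin d → ℕ) (j : Fin d) :
    ∏ i, z i ^ (n + Pi.single j 1 : Fin d → ℕ) i = z j * ∏ i, z i ^ n i := by
  simp only [Pi.add_apply, pow_add, Finset.prod_mul_distrib]
  rw [mul_comm]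
  congr 1
  rw [Finset.prod_eq_single j] <;> simp +contextual

/-- The Taylor coefficients of a kernel are a weight times `conj z^n`; the shift absorbs the change
of weight and leaves one factor `conj z_j`. -/
theorem bwd_kern (z : EuclideanSpace ℂ (Fin d)) (hz : ‖z‖ < 1) (j : Fin d) (y : Y) :
    bwd j (kern z hz y) = starRingEnd ℂ (z j) • kern z hz y := by
  refine lp.ext (funext fun n => ?_)
  rw [bwd_apply, kern_apply, lp.coeFn_smul, Pi.smul_apply, kern_apply, smul_smul, smul_smul,
    prod_pow_add_single, map_mul, ← sqrt_ratio_mul_sqrt_weight n j]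
  congr 1
  push_cast
  ring

theorem opPow_bwd_kern (z : EuclideanSpace ℂ (Fin d)) (hz : ‖z‖ < 1) (n : Fin d → ℕ) (y : Y) :
    opPow bwd n (kern z hz y) = starRingEnd ℂ (∏ j, z j ^ n j) • kern z hz y := by
  induction n using multiIndex_induction with
  | h0 => simp [opPow_zero]
  | hs n j ih =>
    rw [opPow_add_single (bwd_commute (Y := Y)), mul_apply_eq_comp, bwd_kern, map_smul, ih,
      prod_pow_add_single, smul_smul, map_mul]

theorem summable_eval {z : EuclideanSpace ℂ (Fin d)} (hz : ‖z‖ < 1) (f : Space d Y) :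
    Summable fun n : Fin d → ℕ => ‖(∏ j, z j ^ n j) • coeff f n‖ := by
  refine Summable.of_nonneg_of_le (fun n => norm_nonneg _) (fun n => ?_)
    ((hasSum_weight_mul_norm_prod hz).summable.add (hasSum_norm_sq_apply f).summable)
  rw [coeff, norm_smul, norm_smul, Complex.norm_real, Real.norm_eq_abs,
    abs_of_nonneg (Real.sqrt_nonneg _)]
  have h := Real.sq_sqrt (weight_pos n).le
  have h2 := two_mul_le_add_sq (√(weight n) * ‖∏ j, z j ^ n j‖) ‖f n‖
  rw [mul_pow, h] at h2
  have h3 : 0 ≤ √(weight n) * ‖∏ j, z j ^ n j‖ * ‖f n‖ := by positivity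
  linarith

variable [CompleteSpace Y]

/-- Evaluation at a point of the ball as a bounded operator. -/
noncomputable def evalAt (z : EuclideanSpace ℂ (Fin d)) (hz : ‖z‖ < 1) : Space d Y →L[ℂ] Y :=
  ContinuousLinearMap.adjoint (kern z hz)

theorem hasSum_eval {z : EuclideanSpace ℂ (Fin d)} (hz : ‖z‖ < 1) (f : Space d Y) :
    HasSum (fun n : Fin d → ℕ => (∏ j, z j ^ n j) • coeff f n) (evalAt z hz f) := by
  have hs := (summable_eval hz f).of_norm.hasSum
  convert hs
  refine ext_inner_left ℂ fun y => ?_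
  rw [evalAt, ContinuousLinearMap.adjoint_inner_right]
  refine (lp.hasSum_inner (kern z hz y) f).unique
    ((hs.mapL (innerSL ℂ y)).congr_fun fun n => ?_)
  rw [kern_apply, coeff, innerSL_apply_apply, inner_smul_left, inner_smul_right, inner_smul_right,
    map_mul, Complex.conj_conj, Complex.conj_ofReal]
  ring

theorem eval_eq {z : EuclideanSpace ℂ (Fin d)} (hz : ‖z‖ < 1) (f : Space d Y) :
    eval f z = evalAt z hz f :=
  (hasSum_eval hz f).tsum_eq

/-- Pair `f` with a kernel in the inner product splitting and use that kernels are eigenvectors. -/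
theorem evalAt_eq_add_sum {z : EuclideanSpace ℂ (Fin d)} (hz : ‖z‖ < 1) (f : Space d Y) :
    evalAt z hz f = f 0 + ∑ j, z j • evalAt z hz (bwd j f) := by
  refine ext_inner_left ℂ fun y => ?_
  rw [evalAt, ContinuousLinearMap.adjoint_inner_right, inner_eq_inner_zero_add_sum,
    kern_apply_zero, inner_add_right, inner_sum]
  congr 1
  refine Finset.sum_congr rfl fun j _ => ?_
  rw [bwd_kern, inner_smul_left, inner_smul_right, ContinuousLinearMap.adjoint_inner_right,
    Complex.conj_conj]

theorem evalAt_adjoint_bwd {z : EuclideanSpace ℂ (Fin d)} (hz : ‖z‖ < 1) (j : Fin d)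
    (f : Space d Y) :
    evalAt z hz (ContinuousLinearMap.adjoint (bwd j) f) = z j • evalAt z hz f := by
  refine ext_inner_left ℂ fun y => ?_
  rw [evalAt, ContinuousLinearMap.adjoint_inner_right, ContinuousLinearMap.adjoint_inner_right,
    bwd_kern, inner_smul_left, inner_smul_right, ContinuousLinearMap.adjoint_inner_right,
    Complex.conj_conj]

/-- The splitting of point evaluation, applied to a kernel, is a scalar fixed-point equation for its
value; no series has to be summed. -/
theorem evalAt_kern {z w : EuclideanSpace ℂ (Fin d)} (hz : ‖z‖ < 1) (hw : ‖w‖ < 1) (y : Y) :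
    (1 - ∑ j, z j * starRingEnd ℂ (w j)) • evalAt z hz (kern w hw y) = y := by
  have h := evalAt_eq_add_sum hz (kern w hw y)
  simp only [bwd_kern, kern_apply_zero, map_smul, smul_smul, ← Finset.sum_smul] at h
  rw [sub_smul, one_smul, sub_eq_iff_eq_add]
  exact h

end Kernel

/-! ### Uniqueness of power series coefficients -/

section Uniqueness

variable {Y : Type v} [NormedAddCommGroup Y] [NormedSpace ℂ Y] [CompleteSpace Y]

/-- A power series in one variable that vanishes near the origin has zero coefficients. -/
theorem powerSeries_eq_zero {b : ℕ → Y} {r : ℝ} (hr : 0 < r)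
    (hs : Summable fun k => ‖b k‖ * r ^ k)
    (h : ∀ t : ℂ, ‖t‖ ≤ r → ∑' k, t ^ k • b k = 0) (k : ℕ) : b k = 0 := by
  let p : FormalMultilinearSeries ℂ ℂ Y :=
    fun n => ContinuousMultilinearMap.mkPiRing ℂ (Fin n) (b n)
  let r' : NNReal := ⟨r, hr.le⟩
  have hr' : (0 : ENNReal) < r' := ENNReal.coe_pos.2 hr
  have hrad : (r' : ENNReal) ≤ p.radius := by
    refine p.le_radius_of_summable ?_
    refine hs.congr fun n => ?_
    simp only [p, r', ContinuousMultilinearMap.norm_mkPiRing]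
    rfl
  have hpos : 0 < p.radius := hr'.trans_le hrad
  have hp := (p.hasFPowerSeriesOnBall hpos).hasFPowerSeriesAt
  have hzero : p.sum =ᶠ[nhds 0] 0 := by
    filter_upwards [Metric.closedBall_mem_nhds (0 : ℂ) hr] with t ht
    rw [mem_closedBall_zero_iff] at ht
    rw [FormalMultilinearSeries.sum]
    simpa [p] using h t ht
  have h0 := (hp.congr hzero).eq_zero
  have : p k = 0 := by rw [h0]; rfl
  exact (ContinuousMultilinearMap.mkPiRing_eq_zero_iff _).1 this

/-- A power series in several variables that vanishes on a polydisc has zero coefficients. -/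
theorem multiPowerSeries_eq_zero {d : ℕ} {c : (Fin d → ℕ) → Y} {r : ℝ} (hr : 0 < r)
    (hs : Summable fun n => ‖c n‖ * r ^ ∑ j, n j)
    (h : ∀ z : Fin d → ℂ, (∀ j, ‖z j‖ ≤ r) → ∑' n, (∏ j, z j ^ n j) • c n = 0)
    (n : Fin d → ℕ) : c n = 0 := by
  induction d with
  | zero =>
    have h0 := h (fun j => j.elim0) (fun j => j.elim0)
    rw [tsum_eq_single n (fun m hm => (hm (Subsingleton.elim _ _)).elim)] at h0
    simpa using h0
  | succ d ih =>
    let e : ℕ × (Fin d → ℕ) ≃ (Fin (d + 1) → ℕ) := Fin.consEquiv fun _ => ℕ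
    have he0 : ∀ q, e q 0 = q.1 := fun q => rfl
    have hes : ∀ q j, e q (Fin.succ j) = q.2 j := fun q j => rfl
    have hs1 : Summable fun q : ℕ × (Fin d → ℕ) => ‖c (e q)‖ * (r ^ q.1 * r ^ ∑ j, q.2 j) := by
      refine (e.summable_iff.2 hs).congr fun q => ?_
      simp only [Function.comp, Fin.sum_univ_succ, he0, hes, pow_add]
    have hs2 : ∀ k, Summable fun m : Fin d → ℕ => ‖c (e (k, m))‖ * r ^ ∑ j, m j := by
      intro k
      refine ((hs1.prod_factor k).mul_left (r ^ k)⁻¹).congr fun m => ?_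
      have := (pow_pos hr k).ne'
      field_simp
    have hbound : ∀ z : Fin d → ℂ, (∀ j, ‖z j‖ ≤ r) → ∀ m : Fin d → ℕ,
        ‖∏ j, z j ^ m j‖ ≤ r ^ ∑ j, m j := by
      intro z hz m
      rw [norm_prod, ← Finset.prod_pow_eq_pow_sum]
      refine Finset.prod_le_prod (fun j _ => norm_nonneg _) fun j _ => ?_
      rw [norm_pow]
      exact pow_le_pow_left₀ (norm_nonneg _) (hz j) _
    have hs3 : ∀ z : Fin d → ℂ, (∀ j, ‖z j‖ ≤ r) → ∀ k,
        Summable fun m : Fin d → ℕ => ‖(∏ j, z j ^ m j) • c (e (k, m))‖ := by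
      intro z hz k
      refine Summable.of_nonneg_of_le (fun _ => norm_nonneg _) (fun m => ?_) (hs2 k)
      rw [norm_smul, mul_comm]
      exact mul_le_mul_of_nonneg_left (hbound z hz m) (norm_nonneg _)
    -- With the last `d` variables fixed, the sum is a one-variable series in the first; each of its
    -- coefficients is again a series in `d` variables.
    have key : ∀ k, ∀ z : Fin d → ℂ, (∀ j, ‖z j‖ ≤ r) →
        ∑' m : Fin d → ℕ, (∏ j, z j ^ m j) • c (e (k, m)) = 0 := by
      intro k z hz
      refine powerSeries_eq_zero
        (b := fun k => ∑' m : Fin d → ℕ, (∏ j, z j ^ m j) • c (e (k, m))) hr ?_ ?_ k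
      · refine Summable.of_nonneg_of_le (fun _ => by positivity) (fun k => ?_) hs1.prod
        rw [mul_comm, ← le_div_iff₀' (pow_pos hr k)]
        refine (norm_tsum_le_tsum_norm (hs3 z hz k)).trans ?_
        rw [div_eq_inv_mul, ← tsum_mul_left]
        have hk := (pow_pos hr k).ne'
        have hcancel : ∀ m : Fin d → ℕ,
            (r ^ k)⁻¹ * (‖c (e (k, m))‖ * (r ^ k * r ^ ∑ j, m j)) =
              ‖c (e (k, m))‖ * r ^ ∑ j, m j := by
          intro m
          field_simp
        simp only [hcancel]
        refine (hs3 z hz k).tsum_le_tsum (fun m => ?_) (hs2 k)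
        rw [norm_smul, mul_comm]
        exact mul_le_mul_of_nonneg_left (hbound z hz m) (norm_nonneg _)
      · intro t ht
        have hsum : Summable fun q : ℕ × (Fin d → ℕ) =>
            t ^ q.1 • (∏ j, z j ^ q.2 j) • c (e q) := by
          refine Summable.of_norm_bounded hs1 fun q => ?_
          rw [norm_smul, norm_smul, norm_pow, ← mul_assoc, mul_comm]
          refine mul_le_mul_of_nonneg_left ?_ (norm_nonneg _)
          exact mul_le_mul (pow_le_pow_left₀ (norm_nonneg _) ht _) (hbound z hz _)
            (norm_nonneg _) (by positivity)
        have h1 := h (Fin.cons t z) (fun j => by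
          induction j using Fin.cases with
          | zero => exact ht
          | succ j => exact hz j)
        rw [← e.tsum_eq] at h1
        simp only [Fin.prod_univ_succ, he0, hes, Fin.cons_zero, Fin.cons_succ, mul_smul] at h1
        rw [hsum.tsum_prod] at h1
        rw [← h1]
        refine tsum_congr fun k => ?_
        exact ((hs3 z hz k).of_norm.tsum_const_smul _).symm
    have := ih (hs2 (n 0)) (key (n 0)) (fun j => n j.succ)
    have hn : e (n 0, fun j => n j.succ) = n := Fin.cons_self_tail n
    rwa [hn] at this

end Uniqueness

/-! ### Elements are determined by their values on the ball -/

section EvalInjective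

variable {d : ℕ} {Y : Type v} [NormedAddCommGroup Y] [InnerProductSpace ℂ Y] [CompleteSpace Y]

theorem eq_zero_of_evalAt_eq_zero {f : Space d Y} (h : ∀ z hz, evalAt z hz f = 0) : f = 0 := by
  -- The polydisc of radius `1 / (d + 1)` lies in the ball because `d < (d + 1)²`.
  have hr : (0 : ℝ) < ((d : ℝ) + 1)⁻¹ := by positivity
  have hball : ∀ z : Fin d → ℂ, (∀ j, ‖z j‖ ≤ ((d : ℝ) + 1)⁻¹) →
      ‖(WithLp.toLp 2 z : EuclideanSpace ℂ (Fin d))‖ < 1 := by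
    intro z hz
    rw [← sq_lt_one_iff₀ (norm_nonneg _), EuclideanSpace.norm_sq_eq]
    calc ∑ j, ‖z j‖ ^ 2 ≤ ∑ _j : Fin d, (((d : ℝ) + 1)⁻¹) ^ 2 :=
          Finset.sum_le_sum fun j _ => pow_le_pow_left₀ (norm_nonneg _) (hz j) 2
      _ = d * (((d : ℝ) + 1)⁻¹) ^ 2 := by simp
      _ < 1 := by
          rw [inv_pow, ← div_eq_mul_inv, div_lt_one (by positivity)]
          have : (0 : ℝ) ≤ d := d.cast_nonneg
          nlinarith
  have hc : ∀ n, coeff f n = 0 := by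
    refine multiPowerSeries_eq_zero hr ?_ ?_
    · have hz := hball (fun _ => ((((d : ℝ) + 1)⁻¹ : ℝ) : ℂ)) fun j => by
        rw [Complex.norm_real, Real.norm_eq_abs, abs_of_pos hr]
      refine (summable_eval hz f).congr fun n => ?_
      rw [norm_smul, Finset.prod_pow_eq_pow_sum, norm_pow, Complex.norm_real, Real.norm_eq_abs,
        abs_of_pos hr, mul_comm]
    · intro z hz
      have := eval_eq (hball z hz) f
      rw [h] at this
      exact this
  refine lp.ext (funext fun n => ?_)
  have := hc n
  rw [coeff, smul_eq_zero] at this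
  refine this.resolve_left ?_
  exact Complex.ofReal_ne_zero.2 (Real.sqrt_pos.2 (weight_pos n)).ne'

theorem ext_eval {f g : Space d Y}
    (h : ∀ z ∈ Metric.ball (0 : EuclideanSpace ℂ (Fin d)) 1, eval f z = eval g z) : f = g := by
  rw [← sub_eq_zero]
  refine eq_zero_of_evalAt_eq_zero fun z hz => ?_
  rw [map_sub, sub_eq_zero, ← eval_eq, ← eval_eq]
  exact h z (mem_ball_zero_iff.2 hz)

end EvalInjective

/-! ### Separability of the Drury–Arveson space -/

section Separable

instance separableSpace_space {d : ℕ} {Y : Type v} [NormedAddCommGroup Y] [InnerProductSpace ℂ Y]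
    [TopologicalSpace.SeparableSpace Y] : TopologicalSpace.SeparableSpace (Space d Y) := by
  classical
  have hcont : ∀ n : Fin d → ℕ, Continuous fun y : Y => (lp.single 2 n y : Space d Y) :=
    fun n => (lp.isometry_single (E := fun _ : Fin d → ℕ => Y) (p := 2) n).continuous
  have hsep : TopologicalSpace.IsSeparable
      (⋃ n : Fin d → ℕ, Set.range fun y : Y => (lp.single 2 n y : Space d Y)) :=
    .iUnion fun n => TopologicalSpace.isSeparable_range (hcont n)
  have h2 := (hsep.span (R := ℂ)).closure
  rw [← TopologicalSpace.isSeparable_univ_iff]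
  refine h2.mono fun f _ => ?_
  refine mem_closure_of_tendsto (lp.hasSum_single (p := 2) (by norm_num) f)
    (Filter.Eventually.of_forall fun s => ?_)
  refine Submodule.sum_mem _ fun n _ => Submodule.subset_span ?_
  exact Set.mem_iUnion.2 ⟨n, f n, rfl⟩

end Separable

/-! ### Intertwining, invertibility of the pencil and transfer functions -/

section Realization

variable {d : ℕ} {X : Type u} [NormedAddCommGroup X] [InnerProductSpace ℂ X]
  {Y : Type v} [NormedAddCommGroup Y] [InnerProductSpace ℂ Y]
  {E : X →L[ℂ] Y} {T : Fin d → X →L[ℂ] X} {O : X →L[ℂ] Space d Y}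

theorem IsObservability.apply (hO : IsObservability E T O) (x : X) (n : Fin d → ℕ) :
    O x n = ((√(weight n) : ℝ) : ℂ) • E (opPow T n x) := by
  have h := hO x n
  have hw : ((√(weight n) : ℝ) : ℂ) ≠ 0 :=
    Complex.ofReal_ne_zero.2 (Real.sqrt_pos.2 (weight_pos n)).ne'
  have hsq : ((weight n : ℝ) : ℂ) = ((√(weight n) : ℝ) : ℂ) * ((√(weight n) : ℝ) : ℂ) := by
    rw [← Complex.ofReal_mul, Real.mul_self_sqrt (weight_pos n).le]
  rw [coeff, hsq, mul_smul] at h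
  exact smul_right_injective Y hw h

theorem IsObservability.apply_zero (hO : IsObservability E T O) (x : X) : O x 0 = E x := by
  simp [hO.apply, weight_zero, opPow_zero]

/-- Commutativity turns `T^n T_j` into `T^(n + e_j)`, and the shift's factor corrects the weight. -/
theorem IsObservability.intertwine (hO : IsObservability E T O)
    (hT : ∀ i j, Commute (T i) (T j)) (j : Fin d) (x : X) : O (T j x) = bwd j (O x) := by
  refine lp.ext (funext fun n => ?_)
  rw [bwd_apply, hO.apply, hO.apply, opPow_add_single hT, smul_smul, ← Complex.ofReal_mul,
    sqrt_ratio_mul_sqrt_weight]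
  rfl

theorem pencil_apply (T : Fin d → X →L[ℂ] X) (z : EuclideanSpace ℂ (Fin d)) (x : X) :
    pencil T z x = x - ∑ j, z j • T j x := by
  simp [pencil]

theorem isUnit_pencil_bwd [CompleteSpace Y] {z : EuclideanSpace ℂ (Fin d)} (hz : ‖z‖ < 1) :
    IsUnit (pencil (bwd : Fin d → Space d Y →L[ℂ] Space d Y) z) :=
  isUnit_one_sub_of_norm_lt_one ((norm_sum_smul_bwd_op_le z).trans_lt hz)

theorem adjPencil_eq [CompleteSpace X] (T : Fin d → X →L[ℂ] X) (z : EuclideanSpace ℂ (Fin d)) :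
    adjPencil T z = star (pencil T z) := by
  simp [adjPencil, pencil, star_sum, star_smul, ContinuousLinearMap.star_eq_adjoint]

/-- If the observability operator has a bounded left inverse, then `I - Z(z) T` is invertible. -/
theorem IsObservability.isUnit_pencil [CompleteSpace X] (hO : IsObservability E T O)
    (hT : ∀ i j, Commute (T i) (T j)) {L : Space d Y →L[ℂ] X} (hL : ∀ x, L (O x) = x)
    {z : EuclideanSpace ℂ (Fin d)} (hz : ‖z‖ < 1) : IsUnit (pencil T z) := by
  set A : X →L[ℂ] X := ∑ j, z j • T j with hA
  set B : Space d Y →L[ℂ] Space d Y := ∑ j, z j • bwd j with hB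
  -- `A` itself need not be a contraction, but it is similar to a restriction of `B`, whose norm is
  -- at most `‖z‖ < 1`; hence its powers tend to `0`.
  have hOA : ∀ x, O (A x) = B (O x) := by
    intro x
    simp [hA, hB, map_sum, hO.intertwine hT]
  have hpow : ∀ n : ℕ, ∀ x, O ((A ^ n) x) = (B ^ n) (O x) := by
    intro n
    induction n with
    | zero => intro x; simp
    | succ n ih =>
      intro x
      rw [pow_succ, pow_succ, mul_apply_eq_comp, mul_apply_eq_comp, ih, hOA]
  have hBpow : ∀ n : ℕ, ∀ f, ‖(B ^ n) f‖ ≤ ‖z‖ ^ n * ‖f‖ := by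
    intro n
    induction n with
    | zero => intro f; simp
    | succ n ih =>
      intro f
      rw [pow_succ, mul_apply_eq_comp, pow_succ, mul_assoc]
      refine (ih _).trans (mul_le_mul_of_nonneg_left ?_ (by positivity))
      simpa [hB] using norm_sum_smul_bwd_le z f
  have hnorm : ∀ n : ℕ, ‖A ^ n‖ ≤ ‖L‖ * ‖z‖ ^ n * ‖O‖ := by
    intro n
    refine ContinuousLinearMap.opNorm_le_bound _ (by positivity) fun x => ?_
    rw [← hL ((A ^ n) x), hpow, mul_assoc, mul_assoc]
    refine (L.le_opNorm _).trans (mul_le_mul_of_nonneg_left ?_ (norm_nonneg _))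
    exact (hBpow n _).trans (mul_le_mul_of_nonneg_left (O.le_opNorm _) (by positivity))
  have htend : Filter.Tendsto (fun n : ℕ => ‖L‖ * ‖z‖ ^ n * ‖O‖) Filter.atTop (nhds 0) := by
    simpa using ((tendsto_pow_atTop_nhds_zero_of_lt_one (norm_nonneg z) hz).const_mul
      ‖L‖).mul_const ‖O‖
  obtain ⟨N, hN⟩ := (htend.eventually_lt_const one_pos).exists
  have hu : IsUnit (1 - A ^ N) := isUnit_one_sub_of_norm_lt_one ((hnorm N).trans_lt hN)
  -- `1 - A` is a factor of the invertible `1 - A ^ N`, and the factors commute.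
  have hfac : (1 - A) * ∑ i ∈ Finset.range N, A ^ i = 1 - A ^ N := mul_neg_geom_sum A N
  have hcomm : Commute (1 - A) (∑ i ∈ Finset.range N, A ^ i) :=
    Commute.sum_right _ _ _ fun i _ => ((Commute.one_left _).sub_left ((Commute.refl A).pow_right i))
  rw [← hfac] at hu
  exact (hcomm.isUnit_mul_iff.1 hu).1

/-- In the splitting of evaluation at `O x`, the shifted terms are those that the pencil subtracts;
only the constant term `E x` survives. -/
theorem IsObservability.evalAt_pencil [CompleteSpace Y] (hO : IsObservability E T O)
    (hT : ∀ i j, Commute (T i) (T j)) {z : EuclideanSpace ℂ (Fin d)} (hz : ‖z‖ < 1) (x : X) :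
    evalAt z hz (O (pencil T z x)) = E x := by
  have h := evalAt_eq_add_sum hz (O x)
  rw [pencil_apply, map_sub, map_sub, map_sum, map_sum, h, hO.apply_zero]
  simp only [map_smul, hO.intertwine hT, add_sub_cancel_right]

theorem IsObservability.evalAt_eq [CompleteSpace Y] (hO : IsObservability E T O)
    (hT : ∀ i j, Commute (T i) (T j)) {z : EuclideanSpace ℂ (Fin d)} (hz : ‖z‖ < 1)
    (hu : IsUnit (pencil T z)) (x : X) :
    evalAt z hz (O x) = E (Ring.inverse (pencil T z) x) := by
  rw [← hO.evalAt_pencil hT hz, ← mul_apply_eq_comp, Ring.mul_inverse_cancel _ hu]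
  rfl

theorem isObservability_id :
    IsObservability (proj (0 : Fin d → ℕ)) bwd (ContinuousLinearMap.id ℂ (Space d Y)) := by
  intro f n
  have hsq : ((weight n : ℝ) : ℂ) = ((√(weight n) : ℝ) : ℂ) * ((√(weight n) : ℝ) : ℂ) := by
    rw [← Complex.ofReal_mul, Real.mul_self_sqrt (weight_pos n).le]
  rw [hsq, mul_smul, proj_apply, sqrt_weight_smul_opPow_bwd_zero]
  rfl

/-- The transfer function realization of the point evaluation. -/
theorem evalAt_eq_inverse_pencil [CompleteSpace Y] {z : EuclideanSpace ℂ (Fin d)} (hz : ‖z‖ < 1) :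
    evalAt z hz = (proj (0 : Fin d → ℕ)).comp
      (Ring.inverse (pencil (bwd : Fin d → Space d Y →L[ℂ] Space d Y) z)) :=
  ContinuousLinearMap.ext fun f =>
    isObservability_id.evalAt_eq bwd_commute hz (isUnit_pencil_bwd hz) f

end Realization

/-! ### Telescoping sums along the backward shifts -/

section Telescoping

variable {d : ℕ} {Y : Type v} [NormedAddCommGroup Y] [InnerProductSpace ℂ Y]

/-- By `sum_degree_succ`, the degree-`k` sum of `q` is the difference of the sums of `p` in degrees
`k` and `k + 1`. -/
theorem sum_degree_telescope {p q : Space d Y → ℝ}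
    (h : ∀ f, q f = p f - ∑ j, p (bwd j f)) (f : Space d Y) (K : ℕ) :
    ∑ k ∈ Finset.range K, ∑ n ∈ Finset.piAntidiag Finset.univ k,
        weight n * q (opPow bwd n f) =
      p f - ∑ n ∈ Finset.piAntidiag Finset.univ K, weight n * p (opPow bwd n f) := by
  induction K with
  | zero => simp [weight_zero, opPow_zero]
  | succ K ih =>
    have h1 : ∀ (n : Fin d → ℕ) (j : Fin d),
        opPow bwd (n + Pi.single j 1) f = bwd j (opPow bwd n f) := by
      intro n j
      rw [opPow_add_single (bwd_commute (Y := Y)),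
        ← (commute_opPow (fun i => bwd_commute (Y := Y) j i) n).eq, mul_apply_eq_comp]
    rw [Finset.sum_range_succ, ih, sum_degree_succ K fun n => p (opPow bwd n f)]
    simp only [h, h1, mul_sub, Finset.sum_sub_distrib]
    ring

/-- Telescoping `‖·‖²`, whose defect is the squared constant term, identifies this remainder with
the tail of the series for `‖f‖²`. -/
theorem tendsto_sum_degree_norm_sq (f : Space d Y) :
    Filter.Tendsto (fun K => ∑ n ∈ Finset.piAntidiag Finset.univ K,
      weight n * ‖opPow bwd n f‖ ^ 2) Filter.atTop (nhds 0) := by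
  have h := tendsto_sum_degree (hasSum_norm_sq_apply f)
  have h1 : ∀ n : Fin d → ℕ, ‖f n‖ ^ 2 = weight n * ‖(opPow bwd n f) 0‖ ^ 2 := by
    intro n
    rw [← sqrt_weight_smul_opPow_bwd_zero n f, norm_smul, mul_pow, Complex.norm_real,
      Real.norm_eq_abs, sq_abs, Real.sq_sqrt (weight_pos n).le]
  simp only [h1] at h
  have h2 := sum_degree_telescope (p := fun g : Space d Y => ‖g‖ ^ 2)
    (q := fun g => ‖g 0‖ ^ 2)
    (fun g => by rw [norm_sq_eq_norm_zero_add_sum g, add_sub_cancel_right]) f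
  have h3 := h.const_sub (‖f‖ ^ 2)
  rw [sub_self] at h3
  refine h3.congr fun K => ?_
  rw [h2, sub_sub_cancel]

theorem hasSum_of_defect {p q : Space d Y → ℝ} (h : ∀ f, q f = p f - ∑ j, p (bwd j f))
    (hq : ∀ f, 0 ≤ q f) (hp : ∀ f, 0 ≤ p f) (hp' : ∀ f, p f ≤ ‖f‖ ^ 2) (f : Space d Y) :
    HasSum (fun n => weight n * q (opPow bwd n f)) (p f) := by
  refine hasSum_of_tendsto_sum_degree (fun n => mul_nonneg (weight_pos n).le (hq _)) ?_
  simp only [sum_degree_telescope h]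
  have h1 : Filter.Tendsto (fun K => ∑ n ∈ Finset.piAntidiag Finset.univ K,
      weight n * p (opPow bwd n f)) Filter.atTop (nhds 0) :=
    squeeze_zero
      (fun K => Finset.sum_nonneg fun n _ => mul_nonneg (weight_pos n).le (hp _))
      (fun K => Finset.sum_le_sum fun n _ => mul_le_mul_of_nonneg_left (hp' _) (weight_pos n).le)
      (tendsto_sum_degree_norm_sq f)
  simpa using h1.const_sub (p f)

end Telescoping

/-! ### Multiplication operators and their ranges -/

section Multiplication

variable {d : ℕ} {F : Type u} [NormedAddCommGroup F] [InnerProductSpace ℂ F] [CompleteSpace F]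
  {Y : Type v} [NormedAddCommGroup Y] [InnerProductSpace ℂ Y] [CompleteSpace Y]
  {Φ : EuclideanSpace ℂ (Fin d) → F →L[ℂ] Y} {A : Space d F →L[ℂ] Space d Y}

theorem IsMultiplicationBy.evalAt (h : IsMultiplicationBy Φ A) {z : EuclideanSpace ℂ (Fin d)}
    (hz : ‖z‖ < 1) (f : Space d F) : evalAt z hz (A f) = Φ z (evalAt z hz f) := by
  rw [← eval_eq, ← eval_eq]
  exact h f z (mem_ball_zero_iff.2 hz)

theorem IsMultiplicationBy.adjoint_kern (h : IsMultiplicationBy Φ A)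
    {w : EuclideanSpace ℂ (Fin d)} (hw : ‖w‖ < 1) (y : Y) :
    ContinuousLinearMap.adjoint A (kern w hw y) =
      kern w hw (ContinuousLinearMap.adjoint (Φ w) y) := by
  refine ext_inner_right ℂ fun f => ?_
  rw [ContinuousLinearMap.adjoint_inner_left, ← ContinuousLinearMap.adjoint_inner_right,
    ← ContinuousLinearMap.adjoint_inner_right (kern (Y := F) w hw),
    ContinuousLinearMap.adjoint_inner_left]
  exact congrArg _ (h.evalAt hw f)

/-- The range of a multiplication operator is shift invariant. -/
theorem shiftInvariant_of_forall_mem_iff {N : Submodule ℂ (Space d Y)}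
    (h : ∀ f : Space d Y, f ∈ N ↔ ∃ g : Space d F,
      ∀ z ∈ Metric.ball (0 : EuclideanSpace ℂ (Fin d)) 1, eval f z = Φ z (eval g z)) :
    ShiftInvariant N := by
  intro j f hf
  obtain ⟨g, hg⟩ := (h f).1 hf
  have hshift : ∀ z ∈ Metric.ball (0 : EuclideanSpace ℂ (Fin d)) 1,
      eval (ContinuousLinearMap.adjoint (bwd j) f) z = z j • eval f z := by
    intro z hz
    have hz' := mem_ball_zero_iff.1 hz
    rw [eval_eq hz', eval_eq hz', evalAt_adjoint_bwd]
  refine ⟨_, (h _).2 ⟨ContinuousLinearMap.adjoint (bwd j) g, fun z hz => ?_⟩, hshift⟩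
  have hz' := mem_ball_zero_iff.1 hz
  rw [hshift z hz, hg z hz, eval_eq hz', eval_eq hz', evalAt_adjoint_bwd, map_smul]

/-- For `f` in `N`, `f = A (A* f)` provides the preimage `A* f`. -/
theorem mem_iff_of_comp_adjoint_eq {N : Submodule ℂ (Space d Y)} [N.HasOrthogonalProjection]
    (h : IsMultiplicationBy Φ A)
    (hA : ∀ f, A (ContinuousLinearMap.adjoint A f) = N.starProjection f)
    (hN : ∀ g, A g ∈ N) (f : Space d Y) :
    f ∈ N ↔ ∃ g : Space d F,
      ∀ z ∈ Metric.ball (0 : EuclideanSpace ℂ (Fin d)) 1, eval f z = Φ z (eval g z) := by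
  constructor
  · intro hf
    refine ⟨ContinuousLinearMap.adjoint A f, fun z hz => ?_⟩
    rw [← h _ z hz, hA, Submodule.starProjection_eq_self_iff.2 hf]
  · rintro ⟨g, hg⟩
    have : f = A g := ext_eval fun z hz => by rw [hg z hz, h g z hz]
    exact this ▸ hN g

/-- The kernel identity of a multiplication operator with `A A* = P`. -/
theorem smul_evalAt_starProjection_kern {N : Submodule ℂ (Space d Y)}
    [N.HasOrthogonalProjection] (h : IsMultiplicationBy Φ A)
    (hA : ∀ f, A (ContinuousLinearMap.adjoint A f) = N.starProjection f)
    {z w : EuclideanSpace ℂ (Fin d)} (hz : ‖z‖ < 1) (hw : ‖w‖ < 1) (y : Y) :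
    (1 - ∑ j, z j * starRingEnd ℂ (w j)) •
        DA.evalAt z hz (N.starProjection (kern w hw y)) =
      Φ z (ContinuousLinearMap.adjoint (Φ w) y) := by
  rw [← hA, h.evalAt, h.adjoint_kern, ← map_smul, evalAt_kern]

end Multiplication

/-! ### An inner multiplier for an invariant subspace -/

section Inner

variable {d : ℕ} {Y : Type v} [NormedAddCommGroup Y] [InnerProductSpace ℂ Y] [CompleteSpace Y]
  {N : Submodule ℂ (Space d Y)} [N.HasOrthogonalProjection]

/-- Invariance of `N` under the coordinate multiplications means that `bwd j` preserves its
orthogonal complement. -/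
theorem starProjection_bwd
    (hN : ∀ j, ∀ f ∈ N, ContinuousLinearMap.adjoint (bwd j) f ∈ N) (j : Fin d) (f : Space d Y) :
    N.starProjection (bwd j f) = N.starProjection (bwd j (N.starProjection f)) := by
  rw [← sub_eq_zero, ← map_sub, ← map_sub, Submodule.starProjection_apply_eq_zero_iff,
    Submodule.mem_orthogonal]
  intro m hm
  rw [← ContinuousLinearMap.adjoint_inner_left]
  exact (Submodule.mem_orthogonal _ _).1 (Submodule.sub_starProjection_mem_orthogonal f) _
    (hN j m hm)

omit [CompleteSpace Y] in
theorem norm_sq_starProjection_add (f : Space d Y) :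
    ‖f‖ ^ 2 = ‖N.starProjection f‖ ^ 2 + ‖f - N.starProjection f‖ ^ 2 := by
  have h := norm_add_sq_eq_norm_sq_add_norm_sq_of_inner_eq_zero (𝕜 := ℂ) (N.starProjection f)
    (f - N.starProjection f) ((Submodule.mem_orthogonal _ _).1
      (Submodule.sub_starProjection_mem_orthogonal f) _ (Submodule.starProjection_apply_mem N f))
  rw [add_sub_cancel] at h
  simpa only [sq] using h

variable (N) in
/-- A square root of the defect `P - ∑ S_j P S_j*` of a shift invariant subspace. -/
noncomputable def defect :
    Space d Y →L[ℂ] PiLp 2 fun _ : ULift.{w} (Option (Fin d)) => Space d Y :=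
  (PiLp.continuousLinearEquiv 2 ℂ
    fun _ : ULift.{w} (Option (Fin d)) => Space d Y).symm.toContinuousLinearMap.comp
    (ContinuousLinearMap.pi fun i => i.down.elim
      ((lp.singleContinuousLinearMap ℂ (fun _ : Fin d → ℕ => Y) 2 0).comp
        ((proj 0).comp N.starProjection))
      fun j => (bwd j).comp N.starProjection -
        N.starProjection.comp ((bwd j).comp N.starProjection))

/-- The entry `none` of `defect` is the constant term of the projection of `f`; the entry `some j`
is the part of its `j`-th shift orthogonal to `N`. Pythagoras and the norm splitting add these up.
-/
theorem norm_defect_sq (hN : ∀ j, ∀ f ∈ N, ContinuousLinearMap.adjoint (bwd j) f ∈ N)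
    (f : Space d Y) : ‖defect.{v, w} N f‖ ^ 2 =
      ‖N.starProjection f‖ ^ 2 - ∑ j, ‖N.starProjection (bwd j f)‖ ^ 2 := by
  have hsum : ∑ i, ‖(defect.{v, w} N f) i‖ ^ 2 = ∑ i, ‖(defect.{v, w} N f) (ULift.up i)‖ ^ 2 :=
    Fintype.sum_equiv Equiv.ulift _ _ fun _ => rfl
  rw [PiLp.norm_sq_eq_of_L2, hsum, Fintype.sum_option]
  have h0 : ‖(defect.{v, w} N f) (ULift.up none)‖ = ‖(N.starProjection f) 0‖ :=
    lp.norm_single (E := fun _ : Fin d → ℕ => Y) (p := 2) (by norm_num) _ _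
  have h1 : ∀ j, ‖(defect.{v, w} N f) (ULift.up (some j))‖ ^ 2 =
      ‖bwd j (N.starProjection f)‖ ^ 2 - ‖N.starProjection (bwd j f)‖ ^ 2 := by
    intro j
    rw [starProjection_bwd hN, norm_sq_starProjection_add (N := N) (bwd j (N.starProjection f)),
      add_sub_cancel_left]
    rfl
  simp only [h0, h1, Finset.sum_sub_distrib]
  rw [norm_sq_eq_norm_zero_add_sum (N.starProjection f)]
  ring

variable {F : Type u} [NormedAddCommGroup F] [InnerProductSpace ℂ F] [CompleteSpace F]
  {G : Space d Y →L[ℂ] F}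

omit [CompleteSpace Y] [CompleteSpace F] in
theorem hasSum_weight_mul_norm_sq
    (hG : ∀ f, ‖G f‖ ^ 2 = ‖N.starProjection f‖ ^ 2 - ∑ j, ‖N.starProjection (bwd j f)‖ ^ 2)
    (f : Space d Y) :
    HasSum (fun n => weight n * ‖G (opPow bwd n f)‖ ^ 2) (‖N.starProjection f‖ ^ 2) :=
  hasSum_of_defect (p := fun f => ‖N.starProjection f‖ ^ 2) (q := fun f => ‖G f‖ ^ 2) hG
    (fun _ => sq_nonneg _) (fun _ => sq_nonneg _)
    (fun f => pow_le_pow_left₀ (norm_nonneg _) (Submodule.norm_starProjection_apply_le N f) 2) f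

/-- Given a square root `G` of the defect of a subspace `N`, there is a McCT-inner multiplier
whose multiplication operator `A` satisfies `A A* = P_N`. -/
theorem exists_isMcCTInner
    (hG : ∀ f, ‖G f‖ ^ 2 = ‖N.starProjection f‖ ^ 2 - ∑ j, ‖N.starProjection (bwd j f)‖ ^ 2) :
    ∃ (Φ : EuclideanSpace ℂ (Fin d) → F →L[ℂ] Y) (A : Space d F →L[ℂ] Space d Y),
      IsMcCTInner Φ ∧ IsMultiplicationBy Φ A ∧
      (∀ f, A (ContinuousLinearMap.adjoint A f) = N.starProjection f) ∧ ∀ g, A g ∈ N := by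
  have hterm : ∀ (f : Space d Y) (n : Fin d → ℕ),
      ‖(((√(weight n) : ℝ) : ℂ) • G.comp (opPow bwd n)) f‖ ^ 2 =
        weight n * ‖G (opPow bwd n f)‖ ^ 2 := by
    intro f n
    rw [smul_apply, norm_smul, mul_pow, Complex.norm_real, Real.norm_eq_abs,
      sq_abs, Real.sq_sqrt (weight_pos n).le]
    rfl
  let Γ : Space d Y →L[ℂ] Space d F :=
    ofFamily (fun n => ((√(weight n) : ℝ) : ℂ) • G.comp (opPow bwd n)) 1 zero_le_one fun f =>
      ⟨‖N.starProjection f‖ ^ 2, by simpa only [hterm] using hasSum_weight_mul_norm_sq hG f, by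
        rw [one_mul]
        exact pow_le_pow_left₀ (norm_nonneg _) (Submodule.norm_starProjection_apply_le N f) 2⟩
  have hΓ : ∀ f n, Γ f n = ((√(weight n) : ℝ) : ℂ) • G (opPow bwd n f) := fun f n => rfl
  have hnorm : ∀ f, ‖Γ f‖ ^ 2 = ‖N.starProjection f‖ ^ 2 := by
    intro f
    refine (hasSum_norm_sq_apply (Γ f)).unique ?_
    have := hasSum_weight_mul_norm_sq hG f
    simp only [← hterm] at this
    exact this
  -- Over `ℂ` the quadratic form determines the operator, so the equality of norms suffices.
  have hΓΓ : ∀ f, ContinuousLinearMap.adjoint Γ (Γ f) = N.starProjection f := by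
    have : ((ContinuousLinearMap.adjoint Γ).comp Γ).toLinearMap =
        N.starProjection.toLinearMap := by
      rw [← ext_inner_map]
      intro f
      change ⟪ContinuousLinearMap.adjoint Γ (Γ f), f⟫_ℂ = ⟪N.starProjection f, f⟫_ℂ
      rw [ContinuousLinearMap.adjoint_inner_left, inner_self_eq_norm_sq_to_K,
        ← sub_add_cancel f (N.starProjection f), inner_add_right,
        sub_add_cancel f (N.starProjection f), inner_self_eq_norm_sq_to_K,
        (Submodule.mem_orthogonal _ _).1
          (Submodule.sub_starProjection_mem_orthogonal f) _ (Submodule.starProjection_apply_mem N f),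
        zero_add]
      exact_mod_cast hnorm f
    exact fun f => congrArg (fun L : Space d Y →ₗ[ℂ] Space d Y => L f) this
  have hΓP : ∀ f, Γ (N.starProjection f) = Γ f := by
    intro f
    rw [← sub_eq_zero, ← map_sub, ← norm_eq_zero, ← sq_eq_zero_iff, hnorm, map_sub,
      Submodule.starProjection_eq_self_iff.2 (Submodule.starProjection_apply_mem N f), sub_self]
    simp
  have hPΓ : ∀ g, N.starProjection (ContinuousLinearMap.adjoint Γ g) =
      ContinuousLinearMap.adjoint Γ g := by
    intro g
    refine ext_inner_left ℂ fun f => ?_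
    rw [← Submodule.inner_starProjection_left_eq_right, ContinuousLinearMap.adjoint_inner_right,
      ContinuousLinearMap.adjoint_inner_right, hΓP]
  -- This is `ev_z G*` on the ball, written with the resolvent of the shifts so that analyticity is
  -- visible.
  let Φ : EuclideanSpace ℂ (Fin d) → F →L[ℂ] Y := fun z =>
    ((proj (0 : Fin d → ℕ)).comp
      (Ring.inverse (pencil (bwd : Fin d → Space d Y →L[ℂ] Space d Y) z))).comp
      (ContinuousLinearMap.adjoint G)
  have hΦ : ∀ z (hz : ‖z‖ < 1) u, Φ z u = evalAt z hz (ContinuousLinearMap.adjoint G u) := by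
    intro z hz u
    rw [evalAt_eq_inverse_pencil]
    rfl
  have hkern : ∀ z (hz : ‖z‖ < 1) y, Γ (kern z hz y) = kern z hz (G (kern z hz y)) := by
    intro z hz y
    refine lp.ext (funext fun n => ?_)
    rw [hΓ, opPow_bwd_kern, kern_apply, map_smul, smul_smul]
  have hmul : IsMultiplicationBy Φ (ContinuousLinearMap.adjoint Γ) := by
    intro h z hz
    have hz' := mem_ball_zero_iff.1 hz
    rw [eval_eq hz', eval_eq hz', hΦ z hz']
    refine ext_inner_left ℂ fun y => ?_
    rw [evalAt, ContinuousLinearMap.adjoint_inner_right, ContinuousLinearMap.adjoint_inner_right,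
      ContinuousLinearMap.adjoint_inner_right, ContinuousLinearMap.adjoint_inner_right, hkern,
      evalAt, ContinuousLinearMap.adjoint_inner_right]
  have hanalytic : AnalyticOnNhd ℂ Φ (Metric.ball 0 1) := by
    intro z hz
    have hu := isUnit_pencil_bwd (Y := Y) (mem_ball_zero_iff.1 hz)
    have hp : AnalyticAt ℂ (pencil (bwd : Fin d → Space d Y →L[ℂ] Space d Y)) z := by
      refine analyticAt_const.sub (Finset.analyticAt_fun_sum _ fun j _ => ?_)
      exact ((EuclideanSpace.proj j : EuclideanSpace ℂ (Fin d) →L[ℂ] ℂ).analyticAt z).smul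
        analyticAt_const
    obtain ⟨U, hU⟩ := hu
    have hinv : AnalyticAt ℂ
        (fun z => Ring.inverse (pencil (bwd : Fin d → Space d Y →L[ℂ] Space d Y) z)) z :=
      AnalyticAt.fun_comp (by rw [← hU]; exact analyticAt_inverse U) hp
    have h1 := ((ContinuousLinearMap.compL ℂ (Space d Y) (Space d Y) Y (proj 0)).analyticAt
      _).fun_comp hinv
    exact (((ContinuousLinearMap.compL ℂ F (Space d Y) Y).flip
      (ContinuousLinearMap.adjoint G)).analyticAt _).fun_comp h1
  have hle : ‖ContinuousLinearMap.adjoint Γ‖ ≤ 1 := by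
    rw [LinearIsometryEquiv.norm_map]
    refine ContinuousLinearMap.opNorm_le_bound _ zero_le_one fun f => ?_
    rw [one_mul, ← pow_le_pow_iff_left₀ (norm_nonneg _) (norm_nonneg _) two_ne_zero, hnorm]
    exact pow_le_pow_left₀ (norm_nonneg _) (Submodule.norm_starProjection_apply_le N f) 2
  have hpi : IsPartialIsometry (ContinuousLinearMap.adjoint Γ) := by
    intro h hh
    -- `Γ* Γ Γ* = Γ*` puts `h - Γ Γ* h` in the kernel; pairing it with `h` gives `‖h‖ = ‖Γ* h‖`.
    have hker : h - Γ (ContinuousLinearMap.adjoint Γ h) ∈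
        LinearMap.ker (ContinuousLinearMap.adjoint Γ).toLinearMap := by
      rw [LinearMap.mem_ker]
      change ContinuousLinearMap.adjoint Γ (h - Γ (ContinuousLinearMap.adjoint Γ h)) = 0
      rw [map_sub, hΓΓ, hPΓ, sub_self]
    have h0 := (Submodule.mem_orthogonal' _ _).1 hh _ hker
    rw [inner_sub_right, ← ContinuousLinearMap.adjoint_inner_left, sub_eq_zero,
      inner_self_eq_norm_sq_to_K, inner_self_eq_norm_sq_to_K] at h0
    have h1 : ‖h‖ ^ 2 = ‖ContinuousLinearMap.adjoint Γ h‖ ^ 2 := by exact_mod_cast h0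
    exact ((pow_left_inj₀ (norm_nonneg _) (norm_nonneg _) two_ne_zero).1 h1).symm
  refine ⟨Φ, ContinuousLinearMap.adjoint Γ, ⟨⟨hanalytic, _, hmul, hle⟩, _, hmul, hpi⟩, hmul,
    fun f => ?_, fun g => Submodule.starProjection_eq_self_iff.1 (hPΓ g)⟩
  rw [ContinuousLinearMap.adjoint_adjoint, hΓΓ]

end Inner

/-! ### Invariant subspaces are ranges of inner multipliers -/

section BeurlingLax

variable {d : ℕ} {Y : Type v} [NormedAddCommGroup Y] [InnerProductSpace ℂ Y] [CompleteSpace Y]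

theorem ShiftInvariant.adjoint_bwd_mem {N : Submodule ℂ (Space d Y)} (h : ShiftInvariant N)
    (j : Fin d) (f : Space d Y) (hf : f ∈ N) : ContinuousLinearMap.adjoint (bwd j) f ∈ N := by
  obtain ⟨g, hg, hgf⟩ := h j f hf
  have : ContinuousLinearMap.adjoint (bwd j) f = g := ext_eval fun z hz => by
    have hz' := mem_ball_zero_iff.1 hz
    rw [hgf z hz, eval_eq hz', eval_eq hz', evalAt_adjoint_bwd]
  exact this ▸ hg

/-- The McCullough–Trent theorem, with the coefficient space in a universe of choice. -/
theorem exists_isMcCTInner_of_invariant [TopologicalSpace.SeparableSpace Y]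
    (N : Submodule ℂ (Space d Y)) [N.HasOrthogonalProjection]
    (hN : ∀ j, ∀ f ∈ N, ContinuousLinearMap.adjoint (bwd j) f ∈ N) :
    ∃ (F : Type (max w v)) (_ : NormedAddCommGroup F) (_ : InnerProductSpace ℂ F)
      (_ : CompleteSpace F) (_ : TopologicalSpace.SeparableSpace F)
      (Φ : EuclideanSpace ℂ (Fin d) → F →L[ℂ] Y) (A : Space d F →L[ℂ] Space d Y),
      IsMcCTInner Φ ∧ IsMultiplicationBy Φ A ∧
      (∀ f, A (ContinuousLinearMap.adjoint A f) = N.starProjection f) ∧ ∀ g, A g ∈ N := by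
  have : SecondCountableTopology (Space d Y) :=
    UniformSpace.secondCountable_of_separable _
  exact ⟨PiLp 2 fun _ : ULift.{w} (Option (Fin d)) => Space d Y, inferInstance, inferInstance,
    inferInstance, inferInstance, exists_isMcCTInner (norm_defect_sq hN)⟩

end BeurlingLax

/-! ### The observability gramian and the kernel of the adjoint -/

section Gramian

variable {d : ℕ} {X : Type u} [NormedAddCommGroup X] [InnerProductSpace ℂ X] [CompleteSpace X]
  {Y : Type v} [NormedAddCommGroup Y] [InnerProductSpace ℂ Y] [CompleteSpace Y]
  {E : X →L[ℂ] Y} {T : Fin d → X →L[ℂ] X}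

omit [CompleteSpace X] [CompleteSpace Y] in
theorem isObservability_observability (h : OutputStable E T) :
    IsObservability E T (observability h) :=
  h.choose_spec

theorem gramian_inverse_apply {h : OutputStable E T} (hobs : ExactlyObservable h) (x : X) :
    ContinuousLinearMap.adjoint (observability h)
      (observability h (Ring.inverse (gramian h) x)) = x := by
  change (gramian h * Ring.inverse (gramian h)) x = x
  rw [Ring.mul_inverse_cancel _ hobs.isUnit]
  rfl

theorem inverse_gramian_apply {h : OutputStable E T} (hobs : ExactlyObservable h) (x : X) :
    Ring.inverse (gramian h)
      (ContinuousLinearMap.adjoint (observability h) (observability h x)) = x := by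
  change (Ring.inverse (gramian h) * gramian h) x = x
  rw [Ring.inverse_mul_cancel _ hobs.isUnit]
  rfl

/-- The projection onto the range of the observability operator is `O P⁻¹ O*`. -/
theorem starProjection_ker_adjoint_observability {h : OutputStable E T}
    (hobs : ExactlyObservable h)
    [(LinearMap.ker (ContinuousLinearMap.adjoint
      (observability h)).toLinearMap).HasOrthogonalProjection] (f : Space d Y) :
    (LinearMap.ker (ContinuousLinearMap.adjoint (observability h)).toLinearMap).starProjection f =
      f - observability h (Ring.inverse (gramian h)
        (ContinuousLinearMap.adjoint (observability h) f)) := by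
  refine Submodule.eq_starProjection_of_mem_of_inner_eq_zero ?_ ?_
  · rw [LinearMap.mem_ker]
    change ContinuousLinearMap.adjoint (observability h) _ = 0
    rw [map_sub, gramian_inverse_apply hobs, sub_self]
  · intro g hg
    have hg' : ContinuousLinearMap.adjoint (observability h) g = 0 := hg
    rw [sub_sub_cancel, ← ContinuousLinearMap.adjoint_inner_right, hg', inner_zero_right]

/-- Taking adjoints in `O T_j = S_j* O` gives `O* S_j = T_j* O*`. -/
theorem adjoint_bwd_mem_ker_adjoint_observability (hT : ∀ i j, Commute (T i) (T j))
    (h : OutputStable E T) (j : Fin d) (f : Space d Y)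
    (hf : f ∈ LinearMap.ker (ContinuousLinearMap.adjoint (observability h)).toLinearMap) :
    ContinuousLinearMap.adjoint (bwd j) f ∈
      LinearMap.ker (ContinuousLinearMap.adjoint (observability h)).toLinearMap := by
  have hf' : ContinuousLinearMap.adjoint (observability h) f = 0 := hf
  rw [LinearMap.mem_ker]
  change ContinuousLinearMap.adjoint (observability h) _ = 0
  refine ext_inner_left ℂ fun x => ?_
  rw [ContinuousLinearMap.adjoint_inner_right, ContinuousLinearMap.adjoint_inner_right,
    ← (isObservability_observability h).intertwine hT, ← ContinuousLinearMap.adjoint_inner_right,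
    hf', inner_zero_right, inner_zero_right]

theorem isUnit_pencil (hT : ∀ i j, Commute (T i) (T j)) {h : OutputStable E T}
    (hobs : ExactlyObservable h) {z : EuclideanSpace ℂ (Fin d)} (hz : ‖z‖ < 1) :
    IsUnit (pencil T z) :=
  (isObservability_observability h).isUnit_pencil hT
    (L := (Ring.inverse (gramian h)).comp (ContinuousLinearMap.adjoint (observability h)))
    (inverse_gramian_apply hobs) hz

theorem isUnit_adjPencil (hT : ∀ i j, Commute (T i) (T j)) {h : OutputStable E T}
    (hobs : ExactlyObservable h) {z : EuclideanSpace ℂ (Fin d)} (hz : ‖z‖ < 1) :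
    IsUnit (adjPencil T z) := by
  rw [adjPencil_eq]
  exact (isUnit_pencil hT hobs hz).star

/-- Adjoint form of the transfer function formula `ev_w O = E (1 - Z(w) T)⁻¹`. -/
theorem adjoint_observability_kern (hT : ∀ i j, Commute (T i) (T j)) {h : OutputStable E T}
    (hobs : ExactlyObservable h) {w : EuclideanSpace ℂ (Fin d)} (hw : ‖w‖ < 1) (y : Y) :
    ContinuousLinearMap.adjoint (observability h) (kern w hw y) =
      Ring.inverse (adjPencil T w) (ContinuousLinearMap.adjoint E y) := by
  rw [adjPencil_eq, Ring.inverse_star]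
  refine ext_inner_left ℂ fun x => ?_
  rw [ContinuousLinearMap.adjoint_inner_right, ← ContinuousLinearMap.adjoint_inner_left,
    ContinuousLinearMap.star_eq_adjoint, ContinuousLinearMap.adjoint_inner_right,
    ContinuousLinearMap.adjoint_inner_right]
  exact congrArg (fun v => ⟪v, y⟫_ℂ)
    ((isObservability_observability h).evalAt_eq hT hw (isUnit_pencil hT hobs hw) x)

end Gramian

theorem one_sub_sum_mul_conj_ne_zero {d : ℕ} {z w : EuclideanSpace ℂ (Fin d)} (hz : ‖z‖ < 1)
    (hw : ‖w‖ < 1) : 1 - ∑ j, z j * starRingEnd ℂ (w j) ≠ 0 := by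
  have h1 : ∑ j, z j * starRingEnd ℂ (w j) = ⟪w, z⟫_ℂ := by
    simp [PiLp.inner_apply]
  rw [h1, sub_ne_zero]
  intro h
  have h2 := norm_inner_le_norm (𝕜 := ℂ) w z
  rw [← h, norm_one] at h2
  have := mul_lt_one_of_nonneg_of_lt_one_left (norm_nonneg w) hw hz.le
  linarith

end DA

/-! ### The interpolation theorem and its Beurling–Lax consequence -/

theorem theoremT (d : ℕ) (Y : Type v) [NormedAddCommGroup Y] [InnerProductSpace ℂ Y]
    [CompleteSpace Y] [TopologicalSpace.SeparableSpace Y] :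
    -- the interpolation theorem
    (∀ (X : Type u) [NormedAddCommGroup X] [InnerProductSpace ℂ X] [CompleteSpace X]
        [TopologicalSpace.SeparableSpace X]
        (E : X →L[ℂ] Y) (T : Fin d → X →L[ℂ] X) (_hcomm : ∀ i j, Commute (T i) (T j))
        (hst : DA.OutputStable E T) (_hobs : DA.ExactlyObservable hst),
      (∀ z ∈ Metric.ball (0 : EuclideanSpace ℂ (Fin d)) 1,
        IsUnit (DA.pencil T z) ∧ IsUnit (DA.adjPencil T z)) ∧
      ∃ (F : Type (max u v)) (_ : NormedAddCommGroup F) (_ : InnerProductSpace ℂ F)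
        (_ : CompleteSpace F) (_ : TopologicalSpace.SeparableSpace F)
        (Φ : EuclideanSpace ℂ (Fin d) → F →L[ℂ] Y),
        DA.IsMcCTInner Φ ∧
        (∀ z ∈ Metric.ball (0 : EuclideanSpace ℂ (Fin d)) 1,
          ∀ w ∈ Metric.ball (0 : EuclideanSpace ℂ (Fin d)) 1,
          (1 - ∑ j, z j * starRingEnd ℂ (w j))⁻¹ •
              (ContinuousLinearMap.id ℂ Y - Φ z ∘L ContinuousLinearMap.adjoint (Φ w)) =
            E ∘L Ring.inverse (DA.pencil T z) ∘L Ring.inverse (DA.gramian hst) ∘L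
              Ring.inverse (DA.adjPencil T w) ∘L ContinuousLinearMap.adjoint E) ∧
        ∀ (x : X) (f : DA.Space d Y),
          ContinuousLinearMap.adjoint (DA.observability hst) f = x ↔
            ∃ h : DA.Space d F, ∀ z ∈ Metric.ball (0 : EuclideanSpace ℂ (Fin d)) 1,
              DA.eval f z =
                E (Ring.inverse (DA.pencil T z) (Ring.inverse (DA.gramian hst) x)) +
                  Φ z (DA.eval h z)) ∧
    -- the Beurling–Lax theorem
    (∀ M : Submodule ℂ (DA.Space d Y), IsClosed (M : Set (DA.Space d Y)) →
      (DA.ShiftInvariant M ↔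
        ∃ (F : Type v) (_ : NormedAddCommGroup F) (_ : InnerProductSpace ℂ F)
          (_ : CompleteSpace F) (_ : TopologicalSpace.SeparableSpace F)
          (Φ : EuclideanSpace ℂ (Fin d) → F →L[ℂ] Y),
          DA.IsMcCTInner Φ ∧
          ∀ f : DA.Space d Y, f ∈ M ↔
            ∃ h : DA.Space d F, ∀ z ∈ Metric.ball (0 : EuclideanSpace ℂ (Fin d)) 1,
              DA.eval f z = Φ z (DA.eval h z))) := by
  refine ⟨?_, ?_⟩
  · intro X _ _ _ _ E T hT hst hobs
    refine ⟨fun z hz => ⟨DA.isUnit_pencil hT hobs (mem_ball_zero_iff.1 hz),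
      DA.isUnit_adjPencil hT hobs (mem_ball_zero_iff.1 hz)⟩, ?_⟩
    let N := LinearMap.ker (ContinuousLinearMap.adjoint (DA.observability hst)).toLinearMap
    have hmem : ∀ f, f ∈ N ↔ ContinuousLinearMap.adjoint (DA.observability hst) f = 0 :=
      fun f => Iff.rfl
    have hclosed : IsClosed (N : Set (DA.Space d Y)) :=
      (ContinuousLinearMap.adjoint (DA.observability hst)).isClosed_ker
    have : CompleteSpace N := hclosed.completeSpace_coe
    obtain ⟨F, _, _, _, _, Φ, A, hΦ, hmul, hA, hAN⟩ :=
      DA.exists_isMcCTInner_of_invariant.{v, u} N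
        (DA.adjoint_bwd_mem_ker_adjoint_observability hT hst)
    have hO := DA.isObservability_observability hst
    refine ⟨F, inferInstance, inferInstance, inferInstance, inferInstance, Φ, hΦ, ?_, ?_⟩
    · intro z hz w hw
      have hz' := mem_ball_zero_iff.1 hz
      have hw' := mem_ball_zero_iff.1 hw
      refine ContinuousLinearMap.ext fun y => ?_
      -- Insert the projection `1 - O P⁻¹ O*`: its first term contributes `y`, the second the
      -- transfer function expression.
      have h1 := DA.smul_evalAt_starProjection_kern hmul hA hz' hw' y
      rw [DA.starProjection_ker_adjoint_observability hobs, map_sub, smul_sub, DA.evalAt_kern,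
        DA.adjoint_observability_kern hT hobs hw',
        hO.evalAt_eq hT hz' (DA.isUnit_pencil hT hobs hz'), sub_eq_iff_eq_add'] at h1
      change (1 - ∑ j, z j * starRingEnd ℂ (w j))⁻¹ •
        (y - Φ z (ContinuousLinearMap.adjoint (Φ w) y)) = _
      rw [inv_smul_eq_iff₀ (DA.one_sub_sum_mul_conj_ne_zero hz' hw'), sub_eq_iff_eq_add]
      exact h1
    · intro x f
      have hval : ∀ z ∈ Metric.ball (0 : EuclideanSpace ℂ (Fin d)) 1,
          DA.eval (f - DA.observability hst (Ring.inverse (DA.gramian hst) x)) z =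
            DA.eval f z -
              E (Ring.inverse (DA.pencil T z) (Ring.inverse (DA.gramian hst) x)) := by
        intro z hz
        have hz' := mem_ball_zero_iff.1 hz
        rw [DA.eval_eq hz', DA.eval_eq hz', map_sub,
          hO.evalAt_eq hT hz' (DA.isUnit_pencil hT hobs hz')]
      -- `O P⁻¹ x` is a particular solution, so `f` is a solution exactly when the difference lies
      -- in `N`, the range of the multiplier.
      have h1 := DA.mem_iff_of_comp_adjoint_eq hmul hA hAN
        (f - DA.observability hst (Ring.inverse (DA.gramian hst) x))
      rw [hmem, map_sub, DA.gramian_inverse_apply hobs, sub_eq_zero] at h1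
      rw [h1]
      refine exists_congr fun h => forall₂_congr fun z hz => ?_
      rw [hval z hz, sub_eq_iff_eq_add']
  · intro M hM
    have : CompleteSpace M := hM.completeSpace_coe
    constructor
    · intro hinv
      obtain ⟨F, _, _, _, _, Φ, A, hΦ, hmul, hA, hAN⟩ :=
        DA.exists_isMcCTInner_of_invariant.{v, v} M hinv.adjoint_bwd_mem
      exact ⟨F, inferInstance, inferInstance, inferInstance, inferInstance, Φ, hΦ,
        DA.mem_iff_of_comp_adjoint_eq hmul hA hAN⟩
    · rintro ⟨F, _, _, _, _, Φ, -, h⟩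
      exact DA.shiftInvariant_of_forall_mem_iff h
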